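/- Let $d\ge 1$, $\alpha_0\in(0,2)$ and $\Lambda\ge 1$. For $\alpha_1,\dots,\alpha_d\in[\alpha_0,2)$ put $\alpha_{\max}=\max_k\alpha_k$, $\beta=\sum_{k=1}^d 1/\alpha_k$, and for $\rho>0$, $x\in\mathbb R^d$ $$M_\rho(x)=\prod_{k=1}^d\bigl(x_k-\rho^{\alpha_{\max}/\alpha_k},\,x_k+\rho^{\alpha_{\max}/\alpha_k}\bigr),\qquad E^k_\rho(x)=\{y:|x_k-y_k|<\rho^{\alpha_{\max}/\alpha_k}\},$$ $$\mu_{\rm axes}(x,dy)=\sum_{k=1}^d(2-\alpha_k)|x_k-y_k|^{-1-\alpha_k}\,dy_k\prod_{i\ne k}\delta_{x_i}(dy_i).$$ For a measurable family of measures $\mu=(\mu(x,\cdot))_{x\in\mathbb R^d}$ on $\mathbb R^d$ and a measurable set $\Omega$ let $\mathcal E^\mu_\Omega(u,u)=\int_\Omega\int_\Omega(u(y)-u(x))^2\,\mu(x,dy)\,dx\in[0,\infty]$, and let $H^{\mu}(\Omega)$ be the set of all $u\in L^2(\Omega)$ with $\mathcal E^\mu_\Omega(u,u)<\infty$. Write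 $\mu\in\mathcal K(\alpha_0,\Lambda)$ if 1. $\int_A\mu(x,B)\,dx=\int_B\mu(x,A)\,dx$ for all Borel sets $A,B\subset\mathbb R^d$; 2. $\mu(x_0,\mathbb R^d\setminus E^k_\rho(x_0))\le\Lambda(2-\alpha_k)\rho^{-\alpha_{\max}}$ for all $x_0\in\mathbb R^d$, $\rho\in(0,2)$ and $k$; 3. $\Lambda^{-1}\mathcal E^\mu_{M_\rho(x_0)}(u,u)\le\mathcal E^{\mu_{\rm axes}}_{M_\rho(x_0)}(u,u)\le\Lambda\,\mathcal E^\mu_{M_\rho(x_0)}(u,u)$ for all $x_0\in\mathbb R^d$, $\rho\in(0,3)$ and $u\in L^2(M_\rho(x_0))$. **Theorem (Sobolev inequality).** (a) Let $d\ge3$. There is a constant $c_1=c_1(d,\alpha_0,\Lambda)>0$ such that for all $\alpha_1,\dots,\alpha_d\in[\alpha_0,2)$, all $\mu\in\mathcal K(\alpha_0,\Lambda)$, $x_0\in\mathbb R^d$, $r\in(0,1]$, $\lambda\in(1,2]$ and $u\in H^{\mu_{\rm axes}}(M_{\lambda r}(x_0))$, $$\|u\|^2_{L^{2\beta/(\beta-1)}(M_r(x_0))}\le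 c_1\Bigl(\mathcal E^\mu_{M_{\lambda r}(x_0)}(u,u)+r^{-\alpha_{\max}}\Bigl(\sum_{k=1}^d(\lambda^{\alpha_{\max}/\alpha_k}-1)^{-\alpha_k}\Bigr)\|u\|^2_{L^2(M_{\lambda r}(x_0))}\Bigr).$$ (b) Let $d\ge1$ and $\beta_0>1$. There is a constant $c_1=c_1(d,\alpha_0,\Lambda,\beta_0)>0$ such that the same holds for all $\alpha_1,\dots,\alpha_d\in[\alpha_0,2)$ with $\beta\ge\beta_0$. -/

import Mathlib

open MeasureTheory ProbabilityTheory
open scoped ENNReal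

noncomputable section

/-- The largest order `α_max = max_k α_k`. -/
def alphaMax {d : ℕ} (α : Fin d → ℝ) : ℝ := ⨆ k, α k

/-- The quantity `β = ∑_k 1 / α_k`. -/
def betaSum {d : ℕ} (α : Fin d → ℝ) : ℝ := ∑ k, 1 / α k

/-- The slab `E_r^k(x) = {y : |x_k - y_k| < r^(α_max / α_k)}`. -/
def slab {d : ℕ} (α : Fin d → ℝ) (k : Fin d) (r : ℝ) (x : Fin d → ℝ) : Set (Fin d → ℝ) :=
  {y | |x k - y k| < r ^ (alphaMax α / α k)}

/-- The anisotropic box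
`M_r(x) = ∏_k (x_k - r^(α_max / α_k), x_k + r^(α_max / α_k))`. -/
def box {d : ℕ} (α : Fin d → ℝ) (r : ℝ) (x : Fin d → ℝ) : Set (Fin d → ℝ) :=
  Set.univ.pi fun k =>
    Set.Ioo (x k - r ^ (alphaMax α / α k)) (x k + r ^ (alphaMax α / α k))

/-- The reference family
`μ_axes(x, dy) = ∑_k (2 - α_k) |x_k - y_k|^(-1 - α_k) dy_k ∏_{i ≠ k} δ_{x_i}(dy_i)`: the `k`-th
summand is the image of the weighted Lebesgue measure on the line under
`t ↦ (x_1, …, x_{k-1}, t, x_{k+1}, …, x_d)`. -/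
def muAxes {d : ℕ} (α : Fin d → ℝ) (x : Fin d → ℝ) : Measure (Fin d → ℝ) :=
  ∑ k, Measure.map (fun t : ℝ => Function.update x k t)
    ((volume : Measure ℝ).withDensity fun t =>
      ENNReal.ofReal ((2 - α k) * |x k - t| ^ (-1 - α k)))

/-- The local energy `𝓔^μ_Ω(u, u) = ∫_Ω ∫_Ω (u(y) - u(x))² μ(x, dy) dx`, with values in
`[0, ∞]`. -/
def energy {d : ℕ} (μ : (Fin d → ℝ) → Measure (Fin d → ℝ)) (Ω : Set (Fin d → ℝ))
    (u : (Fin d → ℝ) → ℝ) : ℝ≥0∞ :=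
  ∫⁻ x in Ω, ∫⁻ y in Ω, ENNReal.ofReal ((u y - u x) ^ 2) ∂(μ x)

/-- Membership in `H^μ(Ω)`: square integrability on `Ω` and finite local energy. Only the
values of `u` on `Ω` matter. -/
def MemH {d : ℕ} (μ : (Fin d → ℝ) → Measure (Fin d → ℝ)) (Ω : Set (Fin d → ℝ))
    (u : (Fin d → ℝ) → ℝ) : Prop :=
  MemLp u 2 (volume.restrict Ω) ∧ energy μ Ω u < ∞

/-- Admissible families of measures for the orders `α` and the constant `Λ`. -/
structure Admissible {d : ℕ} (α : Fin d → ℝ) (Λ : ℝ)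
    (μ : Kernel (Fin d → ℝ) (Fin d → ℝ)) : Prop where
  /-- symmetry -/
  symmetry : ∀ A B : Set (Fin d → ℝ), MeasurableSet A → MeasurableSet B →
    ∫⁻ x in A, μ x B = ∫⁻ x in B, μ x A
  /-- tail bound -/
  tail : ∀ (x₀ : Fin d → ℝ) (ρ : ℝ), 0 < ρ → ρ < 2 → ∀ k : Fin d,
    μ x₀ (slab α k ρ x₀)ᶜ ≤ ENNReal.ofReal (Λ * (2 - α k) * ρ ^ (-alphaMax α))
  /-- comparability of the local energies with those of the reference family -/
  comparability : ∀ (x₀ : Fin d → ℝ) (ρ : ℝ), 0 < ρ → ρ < 3 → ∀ u : (Fin d → ℝ) → ℝ,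
    MemLp u 2 (volume.restrict (box α ρ x₀)) →
      ENNReal.ofReal Λ⁻¹ * energy μ (box α ρ x₀) u ≤ energy (muAxes α) (box α ρ x₀) u ∧
      energy (muAxes α) (box α ρ x₀) u ≤ ENNReal.ofReal Λ * energy μ (box α ρ x₀) u

/-- `c` is a constant in the local Sobolev inequality for all families that are admissible for the
orders `α` and the constant `Λ`. The inequality is one in `[0, ∞]`; its right-hand side is finite,
so it contains the assertion that `u` lies in `L^(2β/(β-1))` of the smaller box. -/
def IsSobolevConstant {d : ℕ} (α : Fin d → ℝ) (Λ c : ℝ) : Prop :=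
  ∀ μ : Kernel (Fin d → ℝ) (Fin d → ℝ), Admissible α Λ μ →
    ∀ (x₀ : Fin d → ℝ) (r lam : ℝ), 0 < r → r ≤ 1 → 1 < lam → lam ≤ 2 →
    ∀ u : (Fin d → ℝ) → ℝ, MemH (muAxes α) (box α (lam * r) x₀) u →
      eLpNorm u (ENNReal.ofReal (2 * betaSum α / (betaSum α - 1)))
          (volume.restrict (box α r x₀)) ^ 2
        ≤ ENNReal.ofReal c *
          (energy μ (box α (lam * r) x₀) u
            + ENNReal.ofReal
                (r ^ (-alphaMax α) * ∑ k, (lam ^ (alphaMax α / α k) - 1) ^ (-α k))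
              * eLpNorm u 2 (volume.restrict (box α (lam * r) x₀)) ^ 2)

end

/-! The crux is a global Sobolev inequality for the axes energy, with a constant that does not blow
up as some `α k` tends to `2`. A cutoff localizes it, and comparability of energies passes from
`muAxes` to `μ`.

The global inequality needs only the squared `L²`-modulus of continuity `sqDiff f h`. Along an axis
the modulus at `t` is at most a multiple of `t ^ α k` times the directional energy
(`le_rpow_mul_weighted_lintegral`). Hence on a box with sides `R ^ (1 / α k)`, whose volume is `R ^
β`, it is at most a multiple of `R` times the total energy. If that volume is twice the volume of
the support of `f`, then for each `x` at least half of the shifts carry `x` off the support, so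
averaging over the shifts gives the weak-type bound `sq_mul_volume_le`.

Truncation makes it strong: the bound is applied to each dyadic layer of `|f|`. The energies of the
layers add up to at most that of `f` (`tsum_dirEnergy_dyadicLayer_le`), and the resulting recursion
for level sets is summed by `tsum_rpow_one_sub_le_tsum`. All constants depend only on `d`, `α₀`, `Λ`
and a lower bound for `β`. -/

/-! ### A robust one-dimensional estimate -/

section Nikolskii

lemma lintegral_comp_half (F : ℝ → ℝ≥0∞) (hF : Measurable F) :
    ∫⁻ s, F (s / 2) = 2 * ∫⁻ s, F s := by
  have h := Real.map_volume_mul_left (a := (1 / 2 : ℝ)) (by norm_num)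
  have h2 : ∫⁻ s, F (s / 2) = ∫⁻ s, F s ∂(Measure.map (fun x : ℝ => 1 / 2 * x) volume) := by
    rw [lintegral_map hF (by fun_prop)]
    simp only [one_div, inv_mul_eq_div]
  rw [h2, h, lintegral_smul_measure]
  norm_num

variable {G : ℝ → ℝ≥0∞} {a t : ℝ}

/-- The substitution `s ↦ s / 2` costs a factor `2`, doubling of `G` costs `4`, and homogeneity of
the weight gives `2 ^ (1 + a)`. -/
lemma weighted_lintegral_half (hG : Measurable G) (hdbl : ∀ s, G (2 * s) ≤ 4 * G s) (T : ℝ) :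
    ENNReal.ofReal (2 ^ (1 + a)) * ∫⁻ s in Set.Ioo 0 T, ENNReal.ofReal (s ^ (-1 - a)) * G s
      ≤ 8 * ∫⁻ s in Set.Ioo 0 (T / 2), ENNReal.ofReal (s ^ (-1 - a)) * G s := by
  set w : ℝ → ℝ≥0∞ := fun s => ENNReal.ofReal (s ^ (-1 - a)) * G s with hw
  have hwm : Measurable w := by fun_prop
  rw [← lintegral_indicator measurableSet_Ioo, ← lintegral_indicator measurableSet_Ioo,
    show (8 : ℝ≥0∞) = 4 * 2 by norm_num, mul_assoc,
    ← lintegral_comp_half _ (hwm.indicator measurableSet_Ioo),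
    ← lintegral_const_mul _ (hwm.indicator measurableSet_Ioo),
    ← lintegral_const_mul _ (by
      exact (hwm.indicator measurableSet_Ioo).comp (by fun_prop : Measurable fun s : ℝ => s / 2))]
  refine lintegral_mono fun s => ?_
  by_cases hs : s ∈ Set.Ioo 0 T
  · have hs' : s / 2 ∈ Set.Ioo 0 (T / 2) := ⟨by linarith [hs.1], by linarith [hs.2]⟩
    rw [Set.indicator_of_mem hs, Set.indicator_of_mem hs']
    have hp : (s / 2) ^ (-1 - a) = 2 ^ (1 + a) * s ^ (-1 - a) := by
      rw [Real.div_rpow hs.1.le (by norm_num), div_eq_mul_inv, ← Real.rpow_neg (by norm_num),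
        mul_comm]
      congr 2
      ring
    have h1 := hdbl (s / 2)
    rw [mul_div_cancel₀ _ (by norm_num : (2 : ℝ) ≠ 0)] at h1
    simp only [hw]
    rw [hp, ENNReal.ofReal_mul (by positivity)]
    calc _ ≤ ENNReal.ofReal (2 ^ (1 + a)) * (ENNReal.ofReal (s ^ (-1 - a)) * (4 * G (s / 2))) := by
          gcongr
      _ = _ := by ring
  · rw [Set.indicator_of_notMem hs]
    simp

/-- This is the source of the factor `2 - a`. By the half-scale comparison `(0, T / 2)` carries at
least the fraction `2 ^ (a - 2)` of the integral, so the top dyadic block carries at most `1 - 2 ^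
(a - 2) ≤ 2 - a`, because `log 2 ≤ 1`. -/
lemma weighted_lintegral_dyadic_le (hG : Measurable G) (hdbl : ∀ s, G (2 * s) ≤ 4 * G s)
    (ha2 : a < 2) {T : ℝ} (hT : 0 < T) :
    ∫⁻ s in Set.Ico (T / 2) T, ENNReal.ofReal (s ^ (-1 - a)) * G s
      ≤ ENNReal.ofReal (2 - a) * ∫⁻ s in Set.Ioo 0 T, ENNReal.ofReal (s ^ (-1 - a)) * G s := by
  have hhalf := weighted_lintegral_half (a := a) hG hdbl T
  set w : ℝ → ℝ≥0∞ := fun s => ENNReal.ofReal (s ^ (-1 - a)) * G s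
  have hsplit : ∫⁻ s in Set.Ioo 0 T, w s
      = (∫⁻ s in Set.Ioo 0 (T / 2), w s) + ∫⁻ s in Set.Ico (T / 2) T, w s := by
    rw [← lintegral_union measurableSet_Ico, Set.Ioo_union_Ico_eq_Ioo (by linarith) (by linarith)]
    rw [Set.disjoint_left]
    intro s hs hs'
    exact absurd hs.2 (not_lt.2 hs'.1)
  set I := ∫⁻ s in Set.Ioo 0 T, w s
  set I' := ∫⁻ s in Set.Ioo 0 (T / 2), w s
  set J := ∫⁻ s in Set.Ico (T / 2) T, w s
  by_cases hI : I = ∞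
  · rw [hI, ENNReal.mul_top (by simpa using ha2)]
    exact le_top
  have hI' : I' ≠ ∞ := ne_top_of_le_ne_top hI (by rw [hsplit]; exact le_self_add)
  have hJ : J ≠ ∞ := ne_top_of_le_ne_top hI (by rw [hsplit]; exact le_add_self)
  have h1 : (2 : ℝ) ^ (1 + a) * I.toReal ≤ 8 * I'.toReal := by
    have := ENNReal.toReal_mono (by finiteness) hhalf
    rwa [ENNReal.toReal_mul, ENNReal.toReal_mul, ENNReal.toReal_ofReal (by positivity)] at this
  have h2 : I.toReal = I'.toReal + J.toReal := by rw [hsplit, ENNReal.toReal_add hI' hJ]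
  have h3 : 8 * (1 - (2 - a)) ≤ (2 : ℝ) ^ (1 + a) := by
    have h4 : (2 : ℝ) ^ (1 + a) = 8 * (2 : ℝ) ^ (a - 2) := by
      rw [show (8 : ℝ) = 2 ^ (3 : ℝ) by norm_num, ← Real.rpow_add (by norm_num)]
      congr 1
      ring
    have h5 : 1 - (2 - a) ≤ (2 : ℝ) ^ (a - 2) := by
      rw [Real.rpow_def_of_pos (by norm_num)]
      have := Real.add_one_le_exp (Real.log 2 * (a - 2))
      have := Real.log_two_lt_d9
      nlinarith
    linarith
  have h4 : J.toReal ≤ (2 - a) * I.toReal := by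
    nlinarith [ENNReal.toReal_nonneg (a := I)]
  rw [← ENNReal.ofReal_toReal hJ, ← ENNReal.ofReal_toReal hI, ← ENNReal.ofReal_mul (by linarith)]
  exact ENNReal.ofReal_le_ofReal h4

/-- Average `htri` over `s` in `[2t, 3t)`: both `s` and `s + t` stay in `[2t, 4t)`, which is the top
dyadic block for `T = 4t`. -/
lemma le_lintegral_of_subadditive (hG : Measurable G)
    (htri : ∀ s t, G t ≤ 2 * G s + 2 * G (s + t)) (ht : 0 < t) :
    ENNReal.ofReal t * G t ≤ 4 * ∫⁻ s in Set.Ico (2 * t) (4 * t), G s := by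
  have h1 : ENNReal.ofReal t * G t = ∫⁻ _ in Set.Ico (2 * t) (3 * t), G t := by
    rw [lintegral_const, Measure.restrict_apply_univ, Real.volume_Ico, mul_comm]
    congr 2
    ring
  have h2 : ∫⁻ s in Set.Ico (2 * t) (3 * t), G (s + t) ≤ ∫⁻ s in Set.Ico (2 * t) (4 * t), G s := by
    rw [← lintegral_indicator measurableSet_Ico, ← lintegral_indicator measurableSet_Ico,
      ← lintegral_add_right_eq_self ((Set.Ico (2 * t) (4 * t)).indicator fun s => G s) t]
    refine lintegral_mono fun s => ?_
    by_cases hs : s ∈ Set.Ico (2 * t) (3 * t)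
    · have hs' : s + t ∈ Set.Ico (2 * t) (4 * t) := ⟨by linarith [hs.1], by linarith [hs.2]⟩
      rw [Set.indicator_of_mem hs, Set.indicator_of_mem hs']
    · rw [Set.indicator_of_notMem hs]
      exact zero_le
  have h3 : ∫⁻ s in Set.Ico (2 * t) (3 * t), G s ≤ ∫⁻ s in Set.Ico (2 * t) (4 * t), G s :=
    lintegral_mono_set (Set.Ico_subset_Ico_right (by linarith))
  calc ENNReal.ofReal t * G t = ∫⁻ _ in Set.Ico (2 * t) (3 * t), G t := h1
    _ ≤ ∫⁻ s in Set.Ico (2 * t) (3 * t), (2 * G s + 2 * G (s + t)) :=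
        lintegral_mono fun s => htri s t
    _ = 2 * (∫⁻ s in Set.Ico (2 * t) (3 * t), G s)
          + 2 * ∫⁻ s in Set.Ico (2 * t) (3 * t), G (s + t) := by
        rw [lintegral_add_left (by fun_prop), lintegral_const_mul _ hG,
          lintegral_const_mul _ (by fun_prop)]
    _ ≤ 2 * (∫⁻ s in Set.Ico (2 * t) (4 * t), G s) + 2 * ∫⁻ s in Set.Ico (2 * t) (4 * t), G s := by
        gcongr
    _ = _ := by ring

/-- A robust pointwise bound for functions with the subadditivity of a squared modulus of
continuity by their weighted integral; the constant does not degenerate as `a → 2`. -/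
lemma le_rpow_mul_weighted_lintegral (hG : Measurable G) (hdbl : ∀ s, G (2 * s) ≤ 4 * G s)
    (htri : ∀ s t, G t ≤ 2 * G s + 2 * G (s + t)) (ha : 0 < a) (ha2 : a < 2) (ht : 0 < t) :
    G t ≤ 256 * ENNReal.ofReal (t ^ a)
      * ∫⁻ s in Set.Ioi 0, ENNReal.ofReal ((2 - a) * s ^ (-1 - a)) * G s := by
  have h1 := le_lintegral_of_subadditive hG htri ht
  have h2 := weighted_lintegral_dyadic_le hG hdbl ha2 (T := 4 * t) (by linarith)
  rw [show 4 * t / 2 = 2 * t by ring] at h2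
  have h3 : ∫⁻ s in Set.Ico (2 * t) (4 * t), G s
      ≤ ENNReal.ofReal ((4 * t) ^ (1 + a))
        * ∫⁻ s in Set.Ico (2 * t) (4 * t), ENNReal.ofReal (s ^ (-1 - a)) * G s := by
    rw [← lintegral_const_mul _ (by fun_prop)]
    refine setLIntegral_mono (by fun_prop) fun s hs => ?_
    have hs0 : 0 < s := by linarith [hs.1]
    rw [← mul_assoc, ← ENNReal.ofReal_mul (by positivity)]
    refine le_mul_of_one_le_left zero_le ?_
    rw [ENNReal.one_le_ofReal, show -1 - a = -(1 + a) by ring, Real.rpow_neg hs0.le,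
      ← div_eq_mul_inv, one_le_div (by positivity)]
    exact Real.rpow_le_rpow hs0.le hs.2.le (by linarith)
  have h4 : ENNReal.ofReal (2 - a)
        * ∫⁻ s in Set.Ioo 0 (4 * t), ENNReal.ofReal (s ^ (-1 - a)) * G s
      ≤ ∫⁻ s in Set.Ioi 0, ENNReal.ofReal ((2 - a) * s ^ (-1 - a)) * G s := by
    rw [← lintegral_const_mul _ (by fun_prop)]
    refine le_trans (lintegral_mono_set Set.Ioo_subset_Ioi_self) (lintegral_mono fun s => ?_)
    rw [ENNReal.ofReal_mul (by linarith), mul_assoc]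
  set E := ∫⁻ s in Set.Ioi 0, ENNReal.ofReal ((2 - a) * s ^ (-1 - a)) * G s
  have h5 : (4 * t) ^ (1 + a) ≤ 64 * (t * t ^ a) := by
    rw [Real.mul_rpow (by norm_num) ht.le, Real.rpow_add ht, Real.rpow_one]
    gcongr
    calc (4 : ℝ) ^ (1 + a) ≤ 4 ^ (3 : ℝ) :=
          Real.rpow_le_rpow_of_exponent_le (by norm_num) (by linarith)
      _ = 64 := by norm_num
  have h6 : ENNReal.ofReal t * G t
      ≤ ENNReal.ofReal t * (256 * ENNReal.ofReal (t ^ a) * E) := by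
    calc ENNReal.ofReal t * G t
        ≤ 4 * (ENNReal.ofReal (64 * (t * t ^ a)) * E) := by
          refine h1.trans ?_
          gcongr
          refine h3.trans ?_
          gcongr
          exact h2.trans h4
      _ = _ := by
          rw [ENNReal.ofReal_mul (by norm_num), ENNReal.ofReal_mul ht.le, ENNReal.ofReal_ofNat,
            show (256 : ℝ≥0∞) = 4 * 64 by norm_num]
          ring
  exact (ENNReal.mul_le_mul_iff_right (by simpa using ht) ENNReal.ofReal_ne_top).1 h6

end Nikolskii

/-! ### Moduli of continuity and the weak-type estimate -/

/-- The squared `L²`-modulus of continuity of `f` for the shift `h`. -/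
noncomputable def sqDiff {d : ℕ} (f : (Fin d → ℝ) → ℝ) (h : Fin d → ℝ) : ℝ≥0∞ :=
  ∫⁻ x, ENNReal.ofReal ((f (x + h) - f x) ^ 2)

/-- The one-sided global energy of order `a` in the direction of the `k`-th coordinate. -/
noncomputable def dirEnergy {d : ℕ} (a : ℝ) (k : Fin d) (f : (Fin d → ℝ) → ℝ) : ℝ≥0∞ :=
  ∫⁻ s in Set.Ioi (0 : ℝ), ENNReal.ofReal ((2 - a) * s ^ (-1 - a)) * sqDiff f (Pi.single k s)

section SqDiff

variable {d : ℕ} {f : (Fin d → ℝ) → ℝ}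

lemma ENNReal.ofReal_add_sq_le (a b : ℝ) :
    ENNReal.ofReal ((a + b) ^ 2) ≤ 2 * ENNReal.ofReal (a ^ 2) + 2 * ENNReal.ofReal (b ^ 2) := by
  rw [← ENNReal.ofReal_ofNat 2, ← ENNReal.ofReal_mul (by norm_num),
    ← ENNReal.ofReal_mul (by norm_num), ← ENNReal.ofReal_add (by positivity) (by positivity)]
  exact ENNReal.ofReal_le_ofReal (by nlinarith [sq_nonneg (a - b)])

lemma measurable_sqDiff (hf : Measurable f) : Measurable (sqDiff f) := by
  unfold sqDiff
  refine Measurable.lintegral_prod_right'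
    (f := fun p : (Fin d → ℝ) × (Fin d → ℝ) => ENNReal.ofReal ((f (p.2 + p.1) - f p.2) ^ 2)) ?_
  fun_prop

lemma sqDiff_zero : sqDiff f 0 = 0 := by simp [sqDiff]

lemma sqDiff_comp_shift (h g : Fin d → ℝ) :
    ∫⁻ x, ENNReal.ofReal ((f (x + g + h) - f (x + g)) ^ 2) = sqDiff f h :=
  lintegral_add_right_eq_self (fun x => ENNReal.ofReal ((f (x + h) - f x) ^ 2)) g

lemma sqDiff_add_le (hf : Measurable f) (h g : Fin d → ℝ) :
    sqDiff f (h + g) ≤ 2 * sqDiff f h + 2 * sqDiff f g := by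
  calc sqDiff f (h + g)
      ≤ ∫⁻ x, (2 * ENNReal.ofReal ((f (x + g + h) - f (x + g)) ^ 2)
          + 2 * ENNReal.ofReal ((f (x + g) - f x) ^ 2)) := by
        refine lintegral_mono fun x => ?_
        refine le_trans (le_of_eq ?_) (ENNReal.ofReal_add_sq_le _ _)
        rw [show x + (h + g) = x + g + h by abel]
        congr 2
        ring
    _ = _ := by
        rw [lintegral_add_left (by fun_prop), lintegral_const_mul _ (by fun_prop),
          lintegral_const_mul _ (by fun_prop), sqDiff_comp_shift]
        rfl

lemma sqDiff_le_add (hf : Measurable f) (h g : Fin d → ℝ) :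
    sqDiff f g ≤ 2 * sqDiff f h + 2 * sqDiff f (h + g) := by
  calc sqDiff f g = ∫⁻ x, ENNReal.ofReal ((f (x + h + g) - f (x + h)) ^ 2) :=
        (sqDiff_comp_shift g h).symm
    _ ≤ ∫⁻ x, (2 * ENNReal.ofReal ((f (x + h) - f x) ^ 2)
          + 2 * ENNReal.ofReal ((f (x + (h + g)) - f x) ^ 2)) := by
        refine lintegral_mono fun x => ?_
        have := ENNReal.ofReal_add_sq_le (f x - f (x + h)) (f (x + (h + g)) - f x)
        rw [sub_sq_comm (f x)] at this
        refine le_trans (le_of_eq ?_) this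
        rw [show x + (h + g) = x + h + g by abel]
        congr 2
        ring
    _ = _ := by
        rw [lintegral_add_left (by fun_prop), lintegral_const_mul _ (by fun_prop),
          lintegral_const_mul _ (by fun_prop)]
        rfl

lemma sqDiff_sum_le {ι : Type*} (hf : Measurable f) (s : Finset ι) (h : ι → Fin d → ℝ) :
    sqDiff f (∑ i ∈ s, h i) ≤ 2 ^ s.card * ∑ i ∈ s, sqDiff f (h i) := by
  classical
  induction s using Finset.induction_on with
  | empty => simp [sqDiff_zero]
  | insert i s hi ih =>
    rw [Finset.sum_insert hi, Finset.sum_insert hi, Finset.card_insert_of_notMem hi]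
    calc sqDiff f (h i + ∑ j ∈ s, h j)
        ≤ 2 * sqDiff f (h i) + 2 * sqDiff f (∑ j ∈ s, h j) := sqDiff_add_le hf _ _
      _ ≤ 2 * (2 ^ s.card * sqDiff f (h i)) + 2 * (2 ^ s.card * ∑ j ∈ s, sqDiff f (h j)) := by
          gcongr
          exact le_mul_of_one_le_left zero_le (one_le_pow₀ (by norm_num))
      _ = _ := by ring

lemma measurable_pi_single (k : Fin d) : Measurable fun s : ℝ => (Pi.single k s : Fin d → ℝ) :=
  measurable_pi_iff.2 fun i => by
    by_cases h : i = k
    · subst h; simpa using measurable_id'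
    · simp [Pi.single_eq_of_ne h]

lemma sqDiff_single_le {a : ℝ} (hf : Measurable f) (k : Fin d) (ha : 0 < a) (ha2 : a < 2) {t : ℝ}
    (ht : 0 < t) :
    sqDiff f (Pi.single k t) ≤ 256 * ENNReal.ofReal (t ^ a) * dirEnergy a k f := by
  refine le_rpow_mul_weighted_lintegral (G := fun s => sqDiff f (Pi.single k s))
    ((measurable_sqDiff hf).comp (measurable_pi_single k)) (fun s => ?_) (fun s t => ?_) ha ha2 ht
  · simp only [two_mul, Pi.single_add]
    refine (sqDiff_add_le hf _ _).trans (le_of_eq ?_)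
    ring
  · simp only [Pi.single_add]
    exact sqDiff_le_add hf _ _

/-- Weak-type estimate: the level set of `f` is controlled by the size of the support of `f` and by
the directional energies of `f`. -/
lemma sq_mul_volume_le (hf : Measurable f) {α : Fin d → ℝ} (hα : ∀ k, 0 < α k ∧ α k < 2)
    (hd : 0 < d) {a : ℝ} (ha : 0 < a) (hsupp : volume {x | f x ≠ 0} = ENNReal.ofReal a)
    {lam : ℝ} :
    ENNReal.ofReal (lam ^ 2) * volume {x | lam ^ 2 ≤ f x ^ 2}
      ≤ 2 ^ (d + 9) * ENNReal.ofReal ((2 * a) ^ (1 / betaSum α)) * ∑ k, dirEnergy (α k) k f := by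
  set β := betaSum α with hβ
  have hβ0 : 0 < β := by
    have : NeZero d := ⟨hd.ne'⟩
    exact Finset.sum_pos (fun k _ => one_div_pos.2 (hα k).1) ⟨0, Finset.mem_univ _⟩
  -- This `R` makes the volume `R ^ β` of the box equal to `2 * a`, and the side lengths give `h k ^
  -- α k ≤ R` in every direction at once.
  set R := (2 * a) ^ (1 / β) with hR
  have hR0 : 0 < R := by positivity
  set Q : Set (Fin d → ℝ) := Set.univ.pi fun k => Set.Ioo 0 (R ^ (1 / α k)) with hQ
  have hQm : MeasurableSet Q := MeasurableSet.univ_pi fun _ => measurableSet_Ioo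
  have hQv : volume Q = ENNReal.ofReal (2 * a) := by
    rw [hQ, Real.volume_pi_Ioo, ← ENNReal.ofReal_prod_of_nonneg (fun k _ => by simp; positivity)]
    simp only [sub_zero]
    rw [← Real.rpow_sum_of_pos hR0, hR, ← Real.rpow_mul (by positivity)]
    have : (1 / β) * ∑ k, 1 / α k = 1 := by
      change (1 / β) * β = 1
      field_simp
    rw [this, Real.rpow_one]
  set P := {x | f x ≠ 0} with hP
  have hPm : MeasurableSet P := hf (measurableSet_singleton 0).compl
  set L := {x | lam ^ 2 ≤ f x ^ 2} with hL
  have hLm : MeasurableSet L := measurableSet_le measurable_const (by fun_prop)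
  have hlow : ∀ x ∈ L, ENNReal.ofReal (lam ^ 2) * ENNReal.ofReal a
      ≤ ∫⁻ h in Q, ENNReal.ofReal ((f (x + h) - f x) ^ 2) := by
    intro x hx
    have hsub : MeasurableSet ((fun h => x + h) ⁻¹' P) := hPm.preimage (by fun_prop)
    -- The shifts that keep `x` in the support have total volume at most `a`, half of that of `Q`.
    have hv : ENNReal.ofReal a ≤ volume (Q \ (fun h => x + h) ⁻¹' P) := by
      refine le_trans (le_of_eq ?_) le_measure_sdiff
      rw [measure_preimage_add, hQv, hsupp, ← ENNReal.ofReal_sub _ ha.le]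
      congr 1
      ring
    calc _ ≤ ENNReal.ofReal (lam ^ 2) * volume (Q \ (fun h => x + h) ⁻¹' P) := by gcongr
      _ = ∫⁻ _ in Q \ (fun h => x + h) ⁻¹' P, ENNReal.ofReal (lam ^ 2) := by
          rw [setLIntegral_const]
      _ ≤ ∫⁻ h in Q \ (fun h => x + h) ⁻¹' P, ENNReal.ofReal ((f (x + h) - f x) ^ 2) := by
          refine setLIntegral_mono (by fun_prop) fun h hh => ENNReal.ofReal_le_ofReal ?_
          have h0 : f (x + h) = 0 := by simpa [hP] using hh.2
          rw [h0, zero_sub, neg_sq]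
          exact hx
      _ ≤ _ := lintegral_mono_set Set.sdiff_subset
  have hup : ∀ h ∈ Q, sqDiff f h ≤ 2 ^ d * (256 * ENNReal.ofReal R * ∑ k, dirEnergy (α k) k f) := by
    intro h hh
    have hsum : h = ∑ k, Pi.single k (h k) := (Finset.univ_sum_single h).symm
    rw [hsum]
    refine (sqDiff_sum_le hf _ _).trans ?_
    rw [Finset.card_univ, Fintype.card_fin]
    gcongr
    rw [Finset.mul_sum]
    refine Finset.sum_le_sum fun k _ => ?_
    have hk := hh k (Set.mem_univ k)
    refine (sqDiff_single_le hf k (hα k).1 (hα k).2 hk.1).trans ?_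
    gcongr
    calc h k ^ α k ≤ (R ^ (1 / α k)) ^ α k := Real.rpow_le_rpow hk.1.le hk.2.le (hα k).1.le
      _ = R := by
        rw [← Real.rpow_mul hR0.le, one_div_mul_cancel (hα k).1.ne', Real.rpow_one]
  have hmain : ENNReal.ofReal (lam ^ 2) * ENNReal.ofReal a * volume L
      ≤ 2 ^ d * (256 * ENNReal.ofReal R * ∑ k, dirEnergy (α k) k f) * ENNReal.ofReal (2 * a) := by
    calc ENNReal.ofReal (lam ^ 2) * ENNReal.ofReal a * volume L
        = ∫⁻ _ in L, ENNReal.ofReal (lam ^ 2) * ENNReal.ofReal a := by rw [setLIntegral_const]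
      _ ≤ ∫⁻ x in L, ∫⁻ h in Q, ENNReal.ofReal ((f (x + h) - f x) ^ 2) :=
          setLIntegral_mono' hLm hlow
      _ ≤ ∫⁻ x, ∫⁻ h in Q, ENNReal.ofReal ((f (x + h) - f x) ^ 2) := setLIntegral_le_lintegral _ _
      _ = ∫⁻ h in Q, sqDiff f h := lintegral_lintegral_swap (by
          refine Measurable.aemeasurable ?_
          unfold Function.uncurry
          fun_prop)
      _ ≤ ∫⁻ _ in Q, 2 ^ d * (256 * ENNReal.ofReal R * ∑ k, dirEnergy (α k) k f) :=
          setLIntegral_mono' hQm hup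
      _ = _ := by rw [setLIntegral_const, hQv]
  have hfac : ENNReal.ofReal a * (ENNReal.ofReal (lam ^ 2) * volume L)
      ≤ ENNReal.ofReal a * (2 ^ (d + 9) * ENNReal.ofReal R * ∑ k, dirEnergy (α k) k f) := by
    refine le_trans (le_of_eq (by ring)) (hmain.trans (le_of_eq ?_))
    rw [ENNReal.ofReal_mul (by norm_num), ENNReal.ofReal_ofNat, pow_add,
      show (2 : ℝ≥0∞) ^ 9 = 256 * 2 by norm_num]
    ring
  exact (ENNReal.mul_le_mul_iff_right (by simpa using ha) ENNReal.ofReal_ne_top).1 hfac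

end SqDiff

/-! ### Dyadic truncation -/

section Truncation

/-- The part of `|t|` between the heights `2 ^ j` and `2 ^ (j + 1)`. -/
noncomputable def dyadicLayer (j : ℤ) (t : ℝ) : ℝ := min |t| (2 ^ (j + 1)) - min |t| (2 ^ j)

lemma measurable_dyadicLayer (j : ℤ) : Measurable (dyadicLayer j) := by
  unfold dyadicLayer
  fun_prop

lemma two_zpow_lt_succ (j : ℤ) : (2 : ℝ) ^ j < 2 ^ (j + 1) :=
  zpow_lt_zpow_right₀ (by norm_num) (by omega)

lemma dyadicLayer_ne_zero_iff {j : ℤ} {t : ℝ} : dyadicLayer j t ≠ 0 ↔ 2 ^ j < |t| := by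
  have := two_zpow_lt_succ j
  unfold dyadicLayer
  constructor
  · intro h
    by_contra! hle
    rw [min_eq_left hle, min_eq_left (hle.trans this.le), sub_self] at h
    exact h rfl
  · intro h
    rw [min_eq_right h.le, sub_ne_zero]
    exact (lt_min h this).ne'

lemma dyadicLayer_eq {j : ℤ} {t : ℝ} (h : 2 ^ (j + 1) < |t|) : dyadicLayer j t = 2 ^ j := by
  have := two_zpow_lt_succ j
  rw [dyadicLayer, min_eq_right h.le, min_eq_right (this.trans h).le, zpow_add₀ (by norm_num)]
  ring

lemma ENNReal.tsum_sq_le_sq_tsum {ι : Type*} (d : ι → ℝ≥0∞) :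
    ∑' i, d i ^ 2 ≤ (∑' i, d i) ^ 2 := by
  rw [sq (∑' i, d i), ← ENNReal.tsum_mul_right]
  refine ENNReal.tsum_le_tsum fun i => ?_
  rw [sq]
  gcongr
  exact ENNReal.le_tsum i

/-- For `|t| ≤ |s|` the increment of the `j`-th layer is the length of the part of `(|t|, |s|]` in
the `j`-th dyadic interval. These parts are disjoint, so the increments sum to at most `|s - t|`,
and a sum of squares is at most the square of the sum. -/
lemma tsum_dyadicLayer_sub_sq_le (s t : ℝ) :
    ∑' j, ENNReal.ofReal ((dyadicLayer j s - dyadicLayer j t) ^ 2)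
      ≤ ENNReal.ofReal ((s - t) ^ 2) := by
  wlog hst : |t| ≤ |s| generalizing s t
  · rw [sub_sq_comm]
    simp only [sub_sq_comm (dyadicLayer _ s)]
    exact this t s (le_of_not_ge hst)
  have hdisj : Pairwise (Function.onFun Disjoint
      fun j : ℤ => Set.Ioc |t| |s| ∩ Set.Ioc ((2 : ℝ) ^ j) (2 ^ (j + 1))) := by
    have hmono : Monotone fun j : ℤ => (2 : ℝ) ^ j := zpow_right_mono₀ (by norm_num)
    intro i j hij
    exact (hmono.pairwise_disjoint_on_Ioc_succ hij).mono Set.inter_subset_right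
      Set.inter_subset_right
  have hsum : ∑' j, ENNReal.ofReal (dyadicLayer j s - dyadicLayer j t)
      ≤ ENNReal.ofReal |s - t| := by
    calc _ ≤ ∑' j : ℤ, volume (Set.Ioc |t| |s| ∩ Set.Ioc ((2 : ℝ) ^ j) (2 ^ (j + 1))) := by
          refine ENNReal.tsum_le_tsum fun j => ?_
          rw [Set.Ioc_inter_Ioc, Real.volume_Ioc, ENNReal.ofReal_le_ofReal_iff']
          have := two_zpow_lt_succ j
          simp only [dyadicLayer, min_def, max_def]
          split_ifs <;> first | (left; linarith) | (right; linarith)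
      _ = volume (⋃ j : ℤ, Set.Ioc |t| |s| ∩ Set.Ioc ((2 : ℝ) ^ j) (2 ^ (j + 1))) :=
          (measure_iUnion hdisj fun _ => measurableSet_Ioc.inter measurableSet_Ioc).symm
      _ ≤ volume (Set.Ioc |t| |s|) := measure_mono (Set.iUnion_subset fun _ => Set.inter_subset_left)
      _ ≤ _ := by
          rw [Real.volume_Ioc]
          exact ENNReal.ofReal_le_ofReal (abs_sub_abs_le_abs_sub s t)
  have hnn : ∀ j, 0 ≤ dyadicLayer j s - dyadicLayer j t := fun j => by
    have := two_zpow_lt_succ j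
    simp only [dyadicLayer, min_def]
    split_ifs <;> linarith
  calc _ = ∑' j, ENNReal.ofReal (dyadicLayer j s - dyadicLayer j t) ^ 2 := by
        simp only [ENNReal.ofReal_pow (hnn _)]
    _ ≤ (∑' j, ENNReal.ofReal (dyadicLayer j s - dyadicLayer j t)) ^ 2 :=
        ENNReal.tsum_sq_le_sq_tsum _
    _ ≤ ENNReal.ofReal |s - t| ^ 2 := by gcongr
    _ = _ := by rw [← ENNReal.ofReal_pow (abs_nonneg _), sq_abs]

variable {d : ℕ} {f : (Fin d → ℝ) → ℝ}

lemma tsum_sqDiff_dyadicLayer_le (hf : Measurable f) (h : Fin d → ℝ) :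
    ∑' j, sqDiff (fun x => dyadicLayer j (f x)) h ≤ sqDiff f h := by
  unfold sqDiff
  rw [← lintegral_tsum fun j => by
    have := measurable_dyadicLayer j
    fun_prop]
  exact lintegral_mono fun x => tsum_dyadicLayer_sub_sq_le _ _

lemma tsum_dirEnergy_dyadicLayer_le (hf : Measurable f) (a : ℝ) (k : Fin d) :
    ∑' j, dirEnergy a k (fun x => dyadicLayer j (f x)) ≤ dirEnergy a k f := by
  unfold dirEnergy
  rw [← lintegral_tsum fun j => by
    have := (measurable_sqDiff ((measurable_dyadicLayer j).comp hf)).comp (measurable_pi_single k)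
    refine Measurable.aemeasurable ?_
    refine Measurable.mul (by fun_prop) this]
  refine lintegral_mono fun s => ?_
  rw [ENNReal.tsum_mul_left]
  gcongr
  exact tsum_sqDiff_dyadicLayer_le hf _

end Truncation

/-! ### A nonlinear recursion -/

section Sequences

lemma ENNReal.rpow_one_sub_le_of_le_mul {m E : ℝ≥0∞} {θ : ℝ} (hθ1 : θ < 1)
    (hm : m ≠ ∞) (h : m ≤ E * m ^ θ) : m ^ (1 - θ) ≤ E := by
  by_cases hm0 : m = 0
  · rw [hm0, ENNReal.zero_rpow_of_pos (by linarith)]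
    exact zero_le
  · have h1 : m ^ (1 - θ) * m ^ θ ≤ E * m ^ θ := by
      rw [← ENNReal.rpow_add _ _ hm0 hm]
      simpa using h
    refine (ENNReal.mul_le_mul_iff_left ?_ ?_).1 h1
    · simp [hm0, hm]
    · simp [hm, hm0]

/-- The nonlinear recursion `c (j + 1) ≤ e j * c j ^ θ` with `θ < 1` bounds the sum of `c` by a
power of the sum of `e`. -/
lemma tsum_rpow_one_sub_le_tsum {c e : ℤ → ℝ≥0∞} {θ : ℝ} (hθ : 0 ≤ θ) (hθ1 : θ < 1)
    (hrec : ∀ j, c (j + 1) ≤ e j * c j ^ θ) (hfin : ∀ n : ℤ, ⨆ j ≤ n, c j ≠ ∞) :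
    (∑' j, c j) ^ (1 - θ) ≤ ∑' j, e j := by
  set E := ∑' j, e j with hE
  have h1θ : 0 < 1 - θ := by linarith
  -- The recursion turns the supremum `m` over `j ≤ n` into `m ≤ E * m ^ θ`; finiteness of `m`
  -- allows division by `m ^ θ`.
  have hpt : ∀ n, c n ≤ E ^ (1 / (1 - θ)) := by
    intro n
    set m := ⨆ j ≤ n, c j with hm
    have hcm : ∀ j ≤ n, c j ≤ m := fun j hj => le_iSup₂ (f := fun j (_ : j ≤ n) => c j) j hj
    have h1 : m ≤ E * m ^ θ := by
      refine iSup₂_le fun j hj => ?_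
      calc c j = c (j - 1 + 1) := by rw [sub_add_cancel]
        _ ≤ e (j - 1) * c (j - 1) ^ θ := hrec _
        _ ≤ E * m ^ θ := by
            gcongr
            · exact ENNReal.le_tsum _
            · exact hcm _ (by omega)
    have h2 := ENNReal.rpow_one_sub_le_of_le_mul hθ1 (hfin n) h1
    rw [one_div, ← ENNReal.rpow_inv_le_iff (by positivity), inv_inv]
    exact (ENNReal.rpow_le_rpow (hcm n le_rfl) h1θ.le).trans h2
  have hS : ∑' j, c j ≤ E ^ (1 / (1 - θ)) := by
    -- The sum over `ℤ` is shift invariant, so the recursion is summed once, with the pointwise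
    -- bound inserted in `c j ^ θ`.
    calc ∑' j, c j = ∑' j, c (j + 1) := ((Equiv.addRight (1 : ℤ)).tsum_eq c).symm
      _ ≤ ∑' j, e j * (E ^ (1 / (1 - θ))) ^ θ := by
          refine ENNReal.tsum_le_tsum fun j => (hrec j).trans ?_
          gcongr
          exact hpt j
      _ = E ^ (1 : ℝ) * E ^ (1 / (1 - θ) * θ) := by
          rw [ENNReal.tsum_mul_right, ENNReal.rpow_mul, ENNReal.rpow_one]
      _ = E ^ (1 / (1 - θ)) := by
          rw [← ENNReal.rpow_add_of_nonneg _ _ (by norm_num) (by positivity)]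
          congr 1
          field_simp
          ring
  calc (∑' j, c j) ^ (1 - θ) ≤ (E ^ (1 / (1 - θ))) ^ (1 - θ) := by gcongr
    _ = E := by rw [← ENNReal.rpow_mul, one_div_mul_cancel h1θ.ne', ENNReal.rpow_one]

end Sequences

/-! ### The global Sobolev inequality -/

section GlobalSobolev

variable {d : ℕ} {f : (Fin d → ℝ) → ℝ}

lemma two_rpow_mul_intCast (p : ℝ) (j : ℤ) : (2 : ℝ) ^ (p * j) = ((2 : ℝ) ^ j) ^ p := by
  rw [← Real.rpow_intCast, ← Real.rpow_mul (by norm_num), mul_comm]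

lemma lintegral_rpow_le_tsum_dyadic (hf : Measurable f) {p : ℝ} (hp : 0 < p) :
    ∫⁻ x, ‖f x‖ₑ ^ p ≤ ENNReal.ofReal (2 ^ p)
      * ∑' j : ℤ, ENNReal.ofReal (2 ^ (p * j)) * volume {x | 2 ^ j < |f x|} := by
  have hm : ∀ j : ℤ, MeasurableSet {x | 2 ^ j < |f x|} := fun j =>
    measurableSet_lt measurable_const (by fun_prop)
  have hpt : ∀ x, ‖f x‖ₑ ^ p ≤ ∑' j : ℤ, {x | 2 ^ j < |f x|}.indicator
      (fun _ => ENNReal.ofReal (2 ^ p) * ENNReal.ofReal (2 ^ (p * j))) x := by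
    intro x
    by_cases hx : f x = 0
    · simp [hx, hp]
    obtain ⟨j, hj⟩ := exists_mem_Ioc_zpow (abs_pos.2 hx) (one_lt_two (α := ℝ))
    refine le_trans ?_ (ENNReal.le_tsum j)
    rw [Set.indicator_of_mem (by exact hj.1), ← ENNReal.ofReal_mul (by positivity),
      Real.enorm_eq_ofReal_abs, ENNReal.ofReal_rpow_of_nonneg (abs_nonneg _) hp.le]
    refine ENNReal.ofReal_le_ofReal ?_
    rw [two_rpow_mul_intCast, ← Real.mul_rpow (by norm_num) (by positivity)]
    refine Real.rpow_le_rpow (abs_nonneg _) (hj.2.trans (le_of_eq ?_)) hp.le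
    rw [zpow_add₀ (by norm_num)]
    ring
  calc ∫⁻ x, ‖f x‖ₑ ^ p
      ≤ ∫⁻ x, ∑' j : ℤ, {x | 2 ^ j < |f x|}.indicator
          (fun _ => ENNReal.ofReal (2 ^ p) * ENNReal.ofReal (2 ^ (p * j))) x := lintegral_mono hpt
    _ = _ := by
      rw [lintegral_tsum fun j => (measurable_const.indicator (hm j)).aemeasurable,
        ← ENNReal.tsum_mul_left]
      refine tsum_congr fun j => ?_
      rw [lintegral_indicator_const (hm j), mul_assoc]

/-- The weak-type bound is applied to the `j`-th layer at height `2 ^ j`: its support is `{2 ^ j <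
|f|}`, and it equals `2 ^ j` on `{2 ^ (j + 1) < |f|}`. The relation `hp` is what balances the powers
of `2 ^ j`. -/
lemma dyadic_recursion (hf : Measurable f) (hsupp : volume {x | f x ≠ 0} ≠ ∞) {α : Fin d → ℝ}
    (hα : ∀ k, 0 < α k ∧ α k < 2) (hd : 0 < d) {p : ℝ} (hβ : 0 < betaSum α)
    (hp : p - 2 = p * (1 / betaSum α)) (j : ℤ) :
    ENNReal.ofReal (2 ^ (p * (j + 1 : ℤ))) * volume {x | 2 ^ (j + 1) < |f x|}
      ≤ (ENNReal.ofReal (2 ^ (p + 1 / betaSum α)) * 2 ^ (d + 9)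
          * ∑ k, dirEnergy (α k) k (fun x => dyadicLayer j (f x)))
        * (ENNReal.ofReal (2 ^ (p * j)) * volume {x | 2 ^ j < |f x|}) ^ (1 / betaSum α) := by
  set θ := 1 / betaSum α with hθ
  have hθ0 : 0 < θ := by positivity
  have hanti : volume {x | 2 ^ (j + 1) < |f x|} ≤ volume {x | 2 ^ j < |f x|} :=
    measure_mono fun x hx => (two_zpow_lt_succ j).trans hx
  by_cases h0 : volume {x | 2 ^ j < |f x|} = 0
  · rw [nonpos_iff_eq_zero.1 (hanti.trans_eq h0), mul_zero]
    exact zero_le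
  have htop : volume {x | 2 ^ j < |f x|} ≠ ∞ := ne_top_of_le_ne_top hsupp
    (measure_mono fun x hx => abs_pos.1 (lt_trans (by positivity) hx))
  set a := (volume {x | 2 ^ j < |f x|}).toReal with ha
  have ha0 : 0 < a := ENNReal.toReal_pos h0 htop
  have hav : volume {x | 2 ^ j < |f x|} = ENNReal.ofReal a := (ENNReal.ofReal_toReal htop).symm
  have hweak := sq_mul_volume_le ((measurable_dyadicLayer j).comp hf) hα hd ha0
    (by simp only [Function.comp_apply, dyadicLayer_ne_zero_iff]; exact hav) (lam := 2 ^ j)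
  have hsub : volume {x | 2 ^ (j + 1) < |f x|}
      ≤ volume {x | ((2 : ℝ) ^ j) ^ 2 ≤ (dyadicLayer j ∘ f) x ^ 2} :=
    measure_mono fun x hx => by
      simp only [Set.mem_ofPred_eq, Function.comp_apply] at hx ⊢
      rw [dyadicLayer_eq hx]
  have hweak' := (mul_le_mul_right hsub (ENNReal.ofReal (((2 : ℝ) ^ j) ^ 2))).trans hweak
  have hpow : (2 : ℝ) ^ (p * (j + 1 : ℤ)) = 2 ^ p * 2 ^ (p * j * θ) * ((2 : ℝ) ^ j) ^ 2 := by
    rw [← Real.rpow_intCast 2 j, ← Real.rpow_natCast, ← Real.rpow_mul (by norm_num),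
      ← Real.rpow_add (by norm_num), ← Real.rpow_add (by norm_num)]
    congr 1
    push_cast
    linear_combination (j : ℝ) * hp
  rw [hav, ← ENNReal.ofReal_mul (by positivity),
    ENNReal.ofReal_rpow_of_nonneg (by positivity) hθ0.le, Real.mul_rpow (by positivity) ha0.le,
    ← Real.rpow_mul (by norm_num), hpow, ENNReal.ofReal_mul (by positivity), mul_assoc]
  calc _ ≤ ENNReal.ofReal (2 ^ p * 2 ^ (p * j * θ)) * (2 ^ (d + 9) * ENNReal.ofReal ((2 * a) ^ θ)
          * ∑ k, dirEnergy (α k) k (dyadicLayer j ∘ f)) := by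
        gcongr
    _ = _ := by
        rw [Real.mul_rpow (by norm_num) ha0.le, Real.rpow_add (by norm_num),
          ENNReal.ofReal_mul (by positivity), ENNReal.ofReal_mul (by positivity),
          ENNReal.ofReal_mul (by positivity), ENNReal.ofReal_mul (by positivity)]
        simp only [Function.comp_def]
        ring

/-- Global anisotropic fractional Sobolev inequality with a robust constant. -/
lemma eLpNorm_sq_le_dirEnergy (hf : Measurable f) (hsupp : volume {x | f x ≠ 0} ≠ ∞)
    {α : Fin d → ℝ} (hα : ∀ k, 0 < α k ∧ α k < 2) (hd : 0 < d) (hβ : 1 < betaSum α) :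
    eLpNorm f (ENNReal.ofReal (2 * betaSum α / (betaSum α - 1))) volume ^ 2
      ≤ 4 * (ENNReal.ofReal (2 ^ (2 * betaSum α / (betaSum α - 1) + 1 / betaSum α)) * 2 ^ (d + 9)
          * ∑ k, dirEnergy (α k) k f) := by
  set β := betaSum α
  set p := 2 * β / (β - 1) with hp
  have hβ1 : 0 < β - 1 := by linarith
  have hβ0 : 0 < β := by linarith
  have hp0 : 0 < p := by positivity
  have hθ1 : 1 / β < 1 := by rw [div_lt_one hβ0]; exact hβ
  have hpθ : p - 2 = p * (1 / β) := by rw [hp]; field_simp; ring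
  set K := ENNReal.ofReal (2 ^ (p + 1 / β)) * 2 ^ (d + 9)
  set c : ℤ → ℝ≥0∞ := fun j => ENNReal.ofReal (2 ^ (p * j)) * volume {x | 2 ^ j < |f x|} with hc
  have hS : (∑' j, c j) ^ (1 - 1 / β)
      ≤ ∑' j, K * ∑ k, dirEnergy (α k) k (fun x => dyadicLayer j (f x)) := by
    refine tsum_rpow_one_sub_le_tsum (by positivity) hθ1
      (fun j => dyadic_recursion hf hsupp hα hd hβ0 hpθ j) fun n => ?_
    -- The terms with `j ≤ n` are bounded by `2 ^ (p * n)` times the volume of the support; this is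
    -- where finite support is needed.
    refine ne_top_of_le_ne_top
      (ENNReal.mul_ne_top (ENNReal.ofReal_ne_top (r := 2 ^ (p * n))) hsupp) (iSup₂_le fun j hj => ?_)
    simp only [hc]
    refine mul_le_mul' (ENNReal.ofReal_le_ofReal ?_) (measure_mono fun x hx => ?_)
    · gcongr
      norm_num
    · exact abs_pos.1 (lt_trans (by positivity) (show (2 : ℝ) ^ j < |f x| from hx))
  have hE : ∑' j, K * ∑ k, dirEnergy (α k) k (fun x => dyadicLayer j (f x))
      ≤ K * ∑ k, dirEnergy (α k) k f := by
    rw [ENNReal.tsum_mul_left, Summable.tsum_finsetSum fun _ _ => ENNReal.summable]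
    gcongr with k
    exact tsum_dirEnergy_dyadicLayer_le hf _ _
  rw [eLpNorm_eq_lintegral_rpow_enorm_toReal (by simpa using hp0) ENNReal.ofReal_ne_top,
    ENNReal.toReal_ofReal hp0.le, ← ENNReal.rpow_natCast, ← ENNReal.rpow_mul]
  -- The exponent of the squared norm, `2 / p`, is exactly the exponent `1 - θ` produced by the
  -- recursion, with `θ = 1 / β`.
  have hexp : 1 / p * (2 : ℕ) = 1 - 1 / β := by rw [hp]; push_cast; field_simp
  have h4 : ENNReal.ofReal (2 ^ p) ^ (1 - 1 / β) = 4 := by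
    rw [ENNReal.ofReal_rpow_of_nonneg (by positivity) (by linarith), ← Real.rpow_mul (by norm_num),
      mul_sub, ← hpθ]
    norm_num
  rw [hexp]
  calc _ ≤ (ENNReal.ofReal (2 ^ p) * ∑' j, c j) ^ (1 - 1 / β) := by
        have := lintegral_rpow_le_tsum_dyadic hf hp0
        gcongr
    _ = 4 * (∑' j, c j) ^ (1 - 1 / β) := by
        rw [ENNReal.mul_rpow_of_nonneg _ _ (by linarith), h4]
    _ ≤ _ := by
        gcongr
        exact hS.trans hE

end GlobalSobolev

/-! ### Product cutoff functions -/

section Cutoff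

/-- The piecewise linear function that is `1` on `[-l, l]` and vanishes off `(-L, L)`. -/
noncomputable def trapezoid (l L t : ℝ) : ℝ := max 0 (min 1 ((L - |t|) / (L - l)))

variable {l L t : ℝ}

lemma trapezoid_nonneg : 0 ≤ trapezoid l L t := le_max_left _ _

lemma trapezoid_le_one : trapezoid l L t ≤ 1 := max_le zero_le_one (min_le_left _ _)

lemma trapezoid_eq_one (hlL : l < L) (ht : |t| ≤ l) : trapezoid l L t = 1 := by
  have : 1 ≤ (L - |t|) / (L - l) := by
    rw [one_le_div (by linarith)]
    linarith
  rw [trapezoid, min_eq_left this, max_eq_right zero_le_one]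

lemma trapezoid_eq_zero (hlL : l < L) (ht : L ≤ |t|) : trapezoid l L t = 0 := by
  have : (L - |t|) / (L - l) ≤ 0 := div_nonpos_of_nonpos_of_nonneg (by linarith) (by linarith)
  exact max_eq_left ((min_le_right _ _).trans this)

lemma abs_trapezoid_sub_le (hlL : l < L) (s : ℝ) :
    |trapezoid l L (t + s) - trapezoid l L t| ≤ min 1 (|s| / (L - l)) := by
  refine le_min ?_ ?_
  · have h1 := trapezoid_nonneg (l := l) (L := L) (t := t)
    have h2 := trapezoid_nonneg (l := l) (L := L) (t := t + s)
    have h3 := trapezoid_le_one (l := l) (L := L) (t := t)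
    have h4 := trapezoid_le_one (l := l) (L := L) (t := t + s)
    rw [abs_le]
    constructor <;> linarith
  · have h0 : 0 < L - l := by linarith
    calc |trapezoid l L (t + s) - trapezoid l L t|
        ≤ |min 1 ((L - |t + s|) / (L - l)) - min 1 ((L - |t|) / (L - l))| := by
          simpa [trapezoid] using abs_max_sub_max_le_max 0 (min 1 ((L - |t + s|) / (L - l))) 0
            (min 1 ((L - |t|) / (L - l)))
      _ ≤ |(L - |t + s|) / (L - l) - (L - |t|) / (L - l)| := by
          simpa using abs_min_sub_min_le_max 1 ((L - |t + s|) / (L - l)) 1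
            ((L - |t|) / (L - l))
      _ = |(|t| - |t + s|)| / (L - l) := by
          rw [← sub_div, abs_div, abs_of_pos h0]
          congr 2
          ring
      _ ≤ |s| / (L - l) := by
          refine div_le_div_of_nonneg_right ?_ h0.le
          refine (abs_abs_sub_abs_le_abs_sub t (t + s)).trans (le_of_eq ?_)
          rw [sub_add_cancel_left, abs_neg]

variable {d : ℕ} {lo hi x₀ : Fin d → ℝ}

/-- Product cutoff: it is `1` on the box around `x₀` with half side lengths `lo` and vanishes off
the box with half side lengths `hi`. -/
noncomputable def cutoff (lo hi x₀ x : Fin d → ℝ) : ℝ := ∏ k, trapezoid (lo k) (hi k) (x k - x₀ k)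

lemma measurable_cutoff : Measurable (cutoff lo hi x₀) := by
  unfold cutoff trapezoid
  fun_prop

lemma cutoff_nonneg (x : Fin d → ℝ) : 0 ≤ cutoff lo hi x₀ x :=
  Finset.prod_nonneg fun _ _ => trapezoid_nonneg

lemma cutoff_le_one (x : Fin d → ℝ) : cutoff lo hi x₀ x ≤ 1 :=
  Finset.prod_le_one (fun _ _ => trapezoid_nonneg) fun _ _ => trapezoid_le_one

lemma cutoff_eq_one (h : ∀ k, lo k < hi k) {x : Fin d → ℝ} (hx : ∀ k, |x k - x₀ k| ≤ lo k) :
    cutoff lo hi x₀ x = 1 :=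
  Finset.prod_eq_one fun k _ => trapezoid_eq_one (h k) (hx k)

lemma cutoff_eq_zero (h : ∀ k, lo k < hi k) {x : Fin d → ℝ} {k : Fin d}
    (hx : hi k ≤ |x k - x₀ k|) : cutoff lo hi x₀ x = 0 :=
  Finset.prod_eq_zero (Finset.mem_univ k) (trapezoid_eq_zero (h k) hx)

/-- A shift along one axis changes only one factor of the product, and the other factors lie in `[0,
1]`. -/
lemma abs_cutoff_sub_le (h : ∀ k, lo k < hi k) (x : Fin d → ℝ) (k : Fin d) (s : ℝ) :
    |cutoff lo hi x₀ (x + Pi.single k s) - cutoff lo hi x₀ x|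
      ≤ min 1 (|s| / (hi k - lo k)) := by
  have hrest : ∏ i ∈ Finset.univ.erase k,
        trapezoid (lo i) (hi i) ((x + Pi.single k s : Fin d → ℝ) i - x₀ i)
      = ∏ i ∈ Finset.univ.erase k, trapezoid (lo i) (hi i) (x i - x₀ i) :=
    Finset.prod_congr rfl fun i hik => by simp [Pi.single_eq_of_ne (Finset.ne_of_mem_erase hik)]
  unfold cutoff
  rw [← Finset.mul_prod_erase _ _ (Finset.mem_univ k), ← Finset.mul_prod_erase Finset.univ
    (fun i => trapezoid (lo i) (hi i) (x i - x₀ i)) (Finset.mem_univ k), hrest, ← sub_mul, abs_mul,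
    abs_of_nonneg (Finset.prod_nonneg fun _ _ => trapezoid_nonneg)]
  refine (mul_le_of_le_one_right (abs_nonneg _)
    (Finset.prod_le_one (fun _ _ => trapezoid_nonneg) fun _ _ => trapezoid_le_one)).trans ?_
  have := abs_trapezoid_sub_le (t := x k - x₀ k) (h k) s
  rwa [show x k - x₀ k + s = (x + Pi.single k s : Fin d → ℝ) k - x₀ k by simp; ring] at this

end Cutoff

/-! ### Energy of a function times a cutoff -/

section Localization

variable {d : ℕ}

/-- Product rule when both points lie in `M`. If only one does, `τ` vanishes at the other and the
difference is `u` times an increment of `τ`; thus increments of `u` enter only within `M`, as a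
local energy requires. -/
lemma sq_mul_sub_mul_le {M : Set (Fin d → ℝ)} {τ u : (Fin d → ℝ) → ℝ}
    (h0 : ∀ x, 0 ≤ τ x) (h1 : ∀ x, τ x ≤ 1) (hM : ∀ x, x ∉ M → τ x = 0) (x y : Fin d → ℝ) {m : ℝ}
    (hm : |τ y - τ x| ≤ m) :
    ENNReal.ofReal ((τ y * u y - τ x * u x) ^ 2)
      ≤ 2 * M.indicator (fun x => M.indicator (fun y => ENNReal.ofReal ((u y - u x) ^ 2)) y) x
        + 2 * ENNReal.ofReal (m ^ 2) * (M.indicator (fun x => ENNReal.ofReal (u x ^ 2)) x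
          + M.indicator (fun x => ENNReal.ofReal (u x ^ 2)) y) := by
  have hm2 : (τ y - τ x) ^ 2 ≤ m ^ 2 := by
    rw [← sq_abs]
    gcongr
  have hm' : ∀ b : ℝ, (b * (τ y - τ x)) ^ 2 ≤ m ^ 2 * b ^ 2 := fun b => by
    rw [mul_pow, mul_comm]
    gcongr
  have hone : ∀ b : ℝ, ENNReal.ofReal ((b * (τ y - τ x)) ^ 2)
      ≤ 2 * ENNReal.ofReal (m ^ 2) * ENNReal.ofReal (b ^ 2) := fun b => by
    calc _ ≤ ENNReal.ofReal (m ^ 2 * b ^ 2) := ENNReal.ofReal_le_ofReal (hm' b)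
      _ = ENNReal.ofReal (m ^ 2) * ENNReal.ofReal (b ^ 2) := ENNReal.ofReal_mul (by positivity)
      _ ≤ _ := by
        gcongr
        exact le_mul_of_one_le_left zero_le (by norm_num)
  by_cases hx : x ∈ M <;> by_cases hy : y ∈ M
  · simp only [Set.indicator_of_mem, hx, hy]
    rw [show τ y * u y - τ x * u x = τ y * (u y - u x) + u x * (τ y - τ x) by ring]
    refine (ENNReal.ofReal_add_sq_le _ _).trans ?_
    gcongr ?_ + ?_
    · refine mul_le_mul_right (ENNReal.ofReal_le_ofReal ?_) _
      rw [mul_pow]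
      exact mul_le_of_le_one_left (sq_nonneg _) (pow_le_one₀ (h0 y) (h1 y))
    · rw [mul_assoc]
      gcongr
      calc _ ≤ ENNReal.ofReal (m ^ 2 * u x ^ 2) := ENNReal.ofReal_le_ofReal (hm' _)
        _ = ENNReal.ofReal (m ^ 2) * ENNReal.ofReal (u x ^ 2) := ENNReal.ofReal_mul (by positivity)
        _ ≤ _ := by
          gcongr
          exact le_self_add
  · have := hone (u x)
    simp only [Set.indicator_of_mem, Set.indicator_of_notMem, hx, hy, not_false_eq_true, hM y hy,
      mul_zero, add_zero, zero_add] at this ⊢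
    refine le_trans (le_of_eq ?_) this
    congr 1
    ring
  · have := hone (u y)
    simp only [Set.indicator_of_mem, Set.indicator_of_notMem, hx, hy, not_false_eq_true, hM x hx,
      mul_zero, zero_add] at this ⊢
    refine le_trans (le_of_eq ?_) this
    congr 1
    ring
  · simp [hM x hx, hM y hy]

/-- The contribution of the shift `h` to the local energy on `M`. -/
noncomputable def localSqDiff (M : Set (Fin d → ℝ)) (u : (Fin d → ℝ) → ℝ) (h : Fin d → ℝ) :
    ℝ≥0∞ :=
  ∫⁻ x, M.indicator
    (fun x => M.indicator (fun y => ENNReal.ofReal ((u y - u x) ^ 2)) (x + h)) x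

lemma measurable_indicator_sq_sub {M : Set (Fin d → ℝ)} (hMm : MeasurableSet M)
    {u : (Fin d → ℝ) → ℝ} (hu : Measurable u) :
    Measurable fun p : (Fin d → ℝ) × (Fin d → ℝ) =>
      M.indicator (fun x => M.indicator (fun y => ENNReal.ofReal ((u y - u x) ^ 2)) (x + p.1))
        p.2 := by
  have : (fun p : (Fin d → ℝ) × (Fin d → ℝ) =>
      M.indicator (fun x => M.indicator (fun y => ENNReal.ofReal ((u y - u x) ^ 2)) (x + p.1)) p.2)
      = (Prod.snd ⁻¹' M ∩ (fun p : (Fin d → ℝ) × (Fin d → ℝ) => p.2 + p.1) ⁻¹' M).indicator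
        fun p => ENNReal.ofReal ((u (p.2 + p.1) - u p.2) ^ 2) := by
    ext p
    by_cases h1 : p.2 ∈ M <;> by_cases h2 : p.2 + p.1 ∈ M <;> simp [h1, h2]
  rw [this]
  refine Measurable.indicator (by fun_prop) (MeasurableSet.inter ?_ ?_)
  · exact hMm.preimage measurable_snd
  · exact hMm.preimage (by fun_prop)

lemma sqDiff_mul_le {M : Set (Fin d → ℝ)} (hMm : MeasurableSet M) {τ u : (Fin d → ℝ) → ℝ}
    (hu : Measurable u) (h0 : ∀ x, 0 ≤ τ x) (h1 : ∀ x, τ x ≤ 1) (hM : ∀ x, x ∉ M → τ x = 0)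
    {h : Fin d → ℝ} {m : ℝ} (hm : ∀ x, |τ (x + h) - τ x| ≤ m) :
    sqDiff (fun x => τ x * u x) h
      ≤ 2 * localSqDiff M u h
        + 4 * ENNReal.ofReal (m ^ 2) * ∫⁻ x in M, ENNReal.ofReal (u x ^ 2) := by
  set N : (Fin d → ℝ) → ℝ≥0∞ := M.indicator fun x => ENNReal.ofReal (u x ^ 2) with hN
  have hNm : Measurable N := Measurable.indicator (by fun_prop) hMm
  have hDm := (measurable_indicator_sq_sub hMm hu).comp (measurable_prodMk_left (x := h))
  simp only [Function.comp_def] at hDm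
  calc sqDiff (fun x => τ x * u x) h
      ≤ ∫⁻ x, (2 * M.indicator
          (fun x => M.indicator (fun y => ENNReal.ofReal ((u y - u x) ^ 2)) (x + h)) x
          + 2 * ENNReal.ofReal (m ^ 2) * (N x + N (x + h))) := by
        refine lintegral_mono fun x => ?_
        refine (sq_mul_sub_mul_le h0 h1 hM x (x + h) (hm x)).trans (le_of_eq ?_)
        by_cases hx : x ∈ M <;> simp [hx, hN]
    _ = _ := by
        rw [lintegral_add_left (by fun_prop), lintegral_const_mul _ hDm,
          lintegral_const_mul _ (by fun_prop), lintegral_add_left hNm,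
          lintegral_add_right_eq_self N h, localSqDiff,
          show ∫⁻ x, N x = ∫⁻ x in M, ENNReal.ofReal (u x ^ 2) from lintegral_indicator hMm _]
        ring

/-- Split at `δ`. Below it the integral of `s ^ (1 - a)` yields `1 / (2 - a)`, which cancels the
factor in the weight; above it the tail gives `(2 - a) / a ≤ 2 / a`. Hence no degeneration as `a →
2`. -/
lemma lintegral_min_one_div_sq_le {a δ : ℝ} (ha : 0 < a) (ha2 : a < 2) (hδ : 0 < δ) :
    ∫⁻ s in Set.Ioi (0 : ℝ), ENNReal.ofReal ((2 - a) * s ^ (-1 - a))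
        * ENNReal.ofReal (min 1 (|s| / δ) ^ 2)
      ≤ ENNReal.ofReal ((1 + 2 / a) * δ ^ (-a)) := by
  have hsmall : ∫⁻ s in Set.Ioc 0 δ, ENNReal.ofReal ((2 - a) * s ^ (-1 - a))
        * ENNReal.ofReal (min 1 (|s| / δ) ^ 2) ≤ ENNReal.ofReal (δ ^ (-a)) := by
    have hint : IntegrableOn (fun s : ℝ => (2 - a) / δ ^ 2 * s ^ (1 - a)) (Set.Ioc 0 δ) := by
      rw [← intervalIntegrable_iff_integrableOn_Ioc_of_le hδ.le]
      exact (intervalIntegral.intervalIntegrable_rpow' (by linarith)).const_mul _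
    calc _ ≤ ∫⁻ s in Set.Ioc 0 δ, ENNReal.ofReal ((2 - a) / δ ^ 2 * s ^ (1 - a)) := by
          refine setLIntegral_mono (by fun_prop) fun s hs => ?_
          have hs0 : 0 < s := hs.1
          rw [← ENNReal.ofReal_mul (mul_nonneg (by linarith) (by positivity)), abs_of_pos hs0,
            min_eq_right ((div_le_one hδ).2 hs.2), show 1 - a = -1 - a + 2 by ring,
            Real.rpow_add hs0, Real.rpow_two]
          refine ENNReal.ofReal_le_ofReal (le_of_eq ?_)
          field_simp
      _ = ENNReal.ofReal (∫ s in Set.Ioc 0 δ, (2 - a) / δ ^ 2 * s ^ (1 - a)) := by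
          rw [ofReal_integral_eq_lintegral_ofReal hint]
          filter_upwards [ae_restrict_mem measurableSet_Ioc] with s hs
          have := Real.rpow_nonneg hs.1.le (1 - a)
          have : 0 < 2 - a := by linarith
          simp only [Pi.zero_apply]
          positivity
      _ = _ := by
          rw [integral_const_mul, ← intervalIntegral.integral_of_le hδ.le,
            integral_rpow (Or.inl (by linarith)), Real.zero_rpow (by linarith), sub_zero,
            show 1 - a + 1 = -a + 2 by ring, Real.rpow_add hδ, Real.rpow_two]
          have : -a + 2 ≠ 0 := by linarith
          have : 2 - a ≠ 0 := by linarith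
          congr 1
          field_simp
          ring
  have hlarge : ∫⁻ s in Set.Ioi δ, ENNReal.ofReal ((2 - a) * s ^ (-1 - a))
        * ENNReal.ofReal (min 1 (|s| / δ) ^ 2) ≤ ENNReal.ofReal (2 / a * δ ^ (-a)) := by
    have hint : IntegrableOn (fun s : ℝ => (2 - a) * s ^ (-1 - a)) (Set.Ioi δ) :=
      (integrableOn_Ioi_rpow_of_lt (by linarith) hδ).const_mul _
    calc _ ≤ ∫⁻ s in Set.Ioi δ, ENNReal.ofReal ((2 - a) * s ^ (-1 - a)) := by
          refine lintegral_mono fun s => mul_le_of_le_one_right zero_le ?_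
          rw [ENNReal.ofReal_le_one]
          exact pow_le_one₀ (le_min zero_le_one (by positivity)) (min_le_left _ _)
      _ = ENNReal.ofReal (∫ s in Set.Ioi δ, (2 - a) * s ^ (-1 - a)) := by
          rw [ofReal_integral_eq_lintegral_ofReal hint]
          filter_upwards [ae_restrict_mem measurableSet_Ioi] with s hs
          have hs0 : 0 < s := hδ.trans hs
          have : 0 < 2 - a := by linarith
          simp only [Pi.zero_apply]
          positivity
      _ ≤ _ := by
          refine ENNReal.ofReal_le_ofReal ?_
          rw [integral_const_mul, integral_Ioi_rpow_of_lt (by linarith) hδ,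
            show -1 - a + 1 = -a by ring, neg_div_neg_eq]
          have := Real.rpow_pos_of_pos hδ (-a)
          rw [div_mul_eq_mul_div, mul_div_assoc']
          gcongr
          linarith
  rw [← Set.Ioc_union_Ioi_eq_Ioi hδ.le, lintegral_union measurableSet_Ioi (by
    rw [Set.disjoint_left]
    intro s hs hs'
    exact absurd hs.2 (not_le.2 hs')), add_mul, one_mul,
    ENNReal.ofReal_add (by positivity) (by positivity)]
  exact add_le_add hsmall hlarge

lemma measurable_localSqDiff {M : Set (Fin d → ℝ)} (hMm : MeasurableSet M)
    {u : (Fin d → ℝ) → ℝ} (hu : Measurable u) : Measurable (localSqDiff M u) :=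
  (measurable_indicator_sq_sub hMm hu).lintegral_prod_right'

lemma dirEnergy_cutoff_mul_le {M : Set (Fin d → ℝ)} (hMm : MeasurableSet M)
    {u : (Fin d → ℝ) → ℝ} (hu : Measurable u) {lo hi x₀ : Fin d → ℝ} (h : ∀ k, lo k < hi k)
    (hM : ∀ x, x ∉ M → cutoff lo hi x₀ x = 0) {a : ℝ} (ha : 0 < a) (ha2 : a < 2) (k : Fin d) :
    dirEnergy a k (fun x => cutoff lo hi x₀ x * u x)
      ≤ 2 * (∫⁻ s in Set.Ioi (0 : ℝ), ENNReal.ofReal ((2 - a) * s ^ (-1 - a))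
          * localSqDiff M u (Pi.single k s))
        + 4 * ENNReal.ofReal ((1 + 2 / a) * (hi k - lo k) ^ (-a))
          * ∫⁻ x in M, ENNReal.ofReal (u x ^ 2) := by
  set N := ∫⁻ x in M, ENNReal.ofReal (u x ^ 2)
  have hDm := (measurable_localSqDiff hMm hu).comp (measurable_pi_single k)
  simp only [Function.comp_def] at hDm
  calc dirEnergy a k (fun x => cutoff lo hi x₀ x * u x)
      ≤ ∫⁻ s in Set.Ioi (0 : ℝ),
          (2 * (ENNReal.ofReal ((2 - a) * s ^ (-1 - a)) * localSqDiff M u (Pi.single k s))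
          + 4 * N * (ENNReal.ofReal ((2 - a) * s ^ (-1 - a))
            * ENNReal.ofReal (min 1 (|s| / (hi k - lo k)) ^ 2))) := by
        refine lintegral_mono fun s => ?_
        refine (mul_le_mul_right (sqDiff_mul_le hMm hu cutoff_nonneg cutoff_le_one hM
          fun x => abs_cutoff_sub_le h x k s) _).trans (le_of_eq ?_)
        ring
    _ = 2 * (∫⁻ s in Set.Ioi (0 : ℝ), ENNReal.ofReal ((2 - a) * s ^ (-1 - a))
          * localSqDiff M u (Pi.single k s))
          + 4 * N * ∫⁻ s in Set.Ioi (0 : ℝ), (ENNReal.ofReal ((2 - a) * s ^ (-1 - a))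
            * ENNReal.ofReal (min 1 (|s| / (hi k - lo k)) ^ 2)) := by
        rw [lintegral_add_left (by fun_prop), lintegral_const_mul _ (by fun_prop),
          lintegral_const_mul _ (by fun_prop)]
    _ ≤ 2 * (∫⁻ s in Set.Ioi (0 : ℝ), ENNReal.ofReal ((2 - a) * s ^ (-1 - a))
          * localSqDiff M u (Pi.single k s))
          + 4 * N * ENNReal.ofReal ((1 + 2 / a) * (hi k - lo k) ^ (-a)) := by
        gcongr
        exact lintegral_min_one_div_sq_le ha ha2 (by linarith [h k])
    _ = _ := by ring

end Localization

/-! ### The reference family -/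

section Axes

variable {d : ℕ} {α : Fin d → ℝ}

lemma lintegral_muAxes (x : Fin d → ℝ) {g : (Fin d → ℝ) → ℝ≥0∞} (hg : Measurable g) :
    ∫⁻ y, g y ∂(muAxes α x) = ∑ k, ∫⁻ s : ℝ, ENNReal.ofReal ((2 - α k) * |s| ^ (-1 - α k))
      * g (x + Pi.single k s) := by
  rw [muAxes, lintegral_finsetSum_measure]
  refine Finset.sum_congr rfl fun k _ => ?_
  have hupd : Measurable fun t : ℝ => Function.update x k t := by fun_prop
  rw [lintegral_map hg hupd, lintegral_withDensity_eq_lintegral_mul _ (by fun_prop) (by fun_prop),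
    ← lintegral_add_left_eq_self _ (x k)]
  refine lintegral_congr fun s => ?_
  have : Function.update x k (x k + s) = x + Pi.single k s := by
    ext i
    by_cases h : i = k
    · subst h; simp
    · simp [h]
  rw [Pi.mul_apply, this]
  congr 4
  rw [sub_add_cancel_left, abs_neg]

/-- The measures `muAxes α x` live on lines, so a Lebesgue-null set need not be null for every `x`.
It is for almost every `x`, by Tonelli in `(x, s)`, since translates of `N` are null. This allows a
Borel representative of `u` in the axes energy. -/
lemma ae_muAxes_eq_zero {N : Set (Fin d → ℝ)} (hN : MeasurableSet N) (h0 : volume N = 0) :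
    ∀ᵐ x : Fin d → ℝ, muAxes α x N = 0 := by
  have hmeas : ∀ k : Fin d, Measurable fun p : (Fin d → ℝ) × ℝ =>
      ENNReal.ofReal ((2 - α k) * |p.2| ^ (-1 - α k))
        * N.indicator 1 (p.1 + Pi.single k p.2) := fun k => by
    have h1 : Measurable (N.indicator (1 : (Fin d → ℝ) → ℝ≥0∞)) := measurable_one.indicator hN
    have h2 : Measurable fun p : (Fin d → ℝ) × ℝ => p.1 + Pi.single k p.2 :=
      measurable_fst.add ((measurable_pi_single k).comp measurable_snd)
    exact Measurable.mul (by fun_prop) (h1.comp h2)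
  have hrep : ∀ x, muAxes α x N = ∑ k, ∫⁻ s : ℝ, ENNReal.ofReal ((2 - α k) * |s| ^ (-1 - α k))
      * N.indicator 1 (x + Pi.single k s) := fun x => by
    rw [← lintegral_muAxes x (measurable_one.indicator hN), lintegral_indicator_one hN]
  have hk : ∀ k, ∀ᵐ x : Fin d → ℝ, ∫⁻ s : ℝ, ENNReal.ofReal ((2 - α k) * |s| ^ (-1 - α k))
      * N.indicator 1 (x + Pi.single k s) = 0 := fun k => by
    have hm := (hmeas k).lintegral_prod_right' (ν := volume)
    refine (lintegral_eq_zero_iff hm).1 ?_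
    rw [lintegral_lintegral_swap (by exact (hmeas k).aemeasurable)]
    have hz : ∀ s : ℝ, ∫⁻ x : Fin d → ℝ, ENNReal.ofReal ((2 - α k) * |s| ^ (-1 - α k))
        * N.indicator 1 (x + Pi.single k s) = 0 := fun s => by
      have h1 : Measurable (N.indicator (1 : (Fin d → ℝ) → ℝ≥0∞)) := measurable_one.indicator hN
      rw [lintegral_const_mul _ (by fun_prop), lintegral_add_right_eq_self,
        lintegral_indicator_one hN, h0, mul_zero]
    simp [hz]
  filter_upwards [ae_all_iff.2 hk] with x hx
  rw [hrep x]
  exact Finset.sum_eq_zero fun k _ => hx k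

lemma energy_muAxes_congr {M : Set (Fin d → ℝ)} (hM : MeasurableSet M)
    {u w : (Fin d → ℝ) → ℝ} (h : u =ᵐ[volume.restrict M] w) :
    energy (muAxes α) M u = energy (muAxes α) M w := by
  obtain ⟨N, hsub, hNm, hN0⟩ := exists_measurable_superset_of_null
    ((ae_restrict_iff' hM).1 h)
  refine lintegral_congr_ae ?_
  filter_upwards [h, ae_restrict_of_ae (ae_muAxes_eq_zero (α := α) hNm hN0)] with x hx hxN
  refine lintegral_congr_ae ?_
  filter_upwards [ae_restrict_mem hM, ae_restrict_of_ae (measure_eq_zero_iff_ae_notMem.1 hxN)]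
    with y hyM hyN
  have hy : u y = w y := by
    by_contra hne
    exact hyN (hsub fun hh => hne (hh hyM))
  rw [hx, hy]

lemma sum_lintegral_localSqDiff_le_energy {M : Set (Fin d → ℝ)} (hM : MeasurableSet M)
    {u : (Fin d → ℝ) → ℝ} (hu : Measurable u) :
    ∑ k, ∫⁻ s in Set.Ioi (0 : ℝ), ENNReal.ofReal ((2 - α k) * s ^ (-1 - α k))
        * localSqDiff M u (Pi.single k s) ≤ energy (muAxes α) M u := by
  have hmeas : ∀ k : Fin d, Measurable fun p : (Fin d → ℝ) × ℝ =>
      ENNReal.ofReal ((2 - α k) * |p.2| ^ (-1 - α k)) * M.indicator (fun x => M.indicator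
        (fun y => ENNReal.ofReal ((u y - u x) ^ 2)) (x + Pi.single k p.2)) p.1 := fun k => by
    have h2 : Measurable fun p : (Fin d → ℝ) × ℝ => ((Pi.single k p.2 : Fin d → ℝ), p.1) :=
      ((measurable_pi_single k).comp measurable_snd).prodMk measurable_fst
    exact Measurable.mul (by fun_prop) ((measurable_indicator_sq_sub hM hu).comp h2)
  have hin : ∀ x, M.indicator (fun x => ∫⁻ y in M, ENNReal.ofReal ((u y - u x) ^ 2) ∂(muAxes α x)) x
      = ∑ k, ∫⁻ s : ℝ, ENNReal.ofReal ((2 - α k) * |s| ^ (-1 - α k)) * M.indicator (fun x =>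
        M.indicator (fun y => ENNReal.ofReal ((u y - u x) ^ 2)) (x + Pi.single k s)) x := fun x => by
    by_cases hx : x ∈ M
    · simp only [Set.indicator_of_mem hx]
      rw [← lintegral_indicator hM,
        lintegral_muAxes x (Measurable.indicator (by fun_prop) hM)]
    · simp [Set.indicator_of_notMem hx]
  rw [energy, ← lintegral_indicator hM, lintegral_congr hin,
    lintegral_finsetSum _ fun k _ => (hmeas k).lintegral_prod_right']
  refine Finset.sum_le_sum fun k _ => ?_
  rw [lintegral_lintegral_swap (by exact (hmeas k).aemeasurable)]
  -- The half-line `s < 0` is discarded, as `dirEnergy` is one-sided.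
  refine le_trans (setLIntegral_mono' measurableSet_Ioi fun s hs => ?_)
    (setLIntegral_le_lintegral (Set.Ioi 0) _)
  have hmx := (measurable_indicator_sq_sub hM hu).comp
    (measurable_prodMk_left (x := (Pi.single k s : Fin d → ℝ)))
  simp only [Function.comp_def] at hmx
  dsimp only
  rw [lintegral_const_mul _ hmx, abs_of_pos hs, localSqDiff]

end Axes

/-! ### The local Sobolev inequality -/

section LocalSobolev

variable {d : ℕ} {α : Fin d → ℝ}

lemma measurableSet_box (ρ : ℝ) (x₀ : Fin d → ℝ) : MeasurableSet (box α ρ x₀) :=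
  MeasurableSet.univ_pi fun _ => measurableSet_Ioo

lemma mem_box_iff {ρ : ℝ} {x₀ x : Fin d → ℝ} :
    x ∈ box α ρ x₀ ↔ ∀ k, |x k - x₀ k| < ρ ^ (alphaMax α / α k) := by
  simp only [box, Set.mem_univ_pi, Set.mem_Ioo, abs_lt]
  refine forall_congr' fun k => ⟨fun h => ?_, fun h => ?_⟩ <;> constructor <;> linarith [h.1, h.2]

lemma volume_box_ne_top (ρ : ℝ) (x₀ : Fin d → ℝ) : volume (box α ρ x₀) ≠ ∞ := by
  rw [box, Real.volume_pi_Ioo]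
  exact ENNReal.prod_ne_top fun _ _ => ENNReal.ofReal_ne_top

lemma le_alphaMax (k : Fin d) : α k ≤ alphaMax α := le_ciSup (Set.finite_range α).bddAbove k

lemma eLpNorm_two_sq {β : Type*} [MeasurableSpace β] (ν : Measure β) (u : β → ℝ) :
    eLpNorm u 2 ν ^ 2 = ∫⁻ x, ENNReal.ofReal (u x ^ 2) ∂ν := by
  rw [eLpNorm_eq_lintegral_rpow_enorm_toReal (by norm_num) (by norm_num), ← ENNReal.rpow_natCast,
    ← ENNReal.rpow_mul]
  norm_num
  refine lintegral_congr fun x => ?_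
  rw [Real.enorm_eq_ofReal_abs, ← ENNReal.ofReal_pow (abs_nonneg _), sq_abs]

/-- The global inequality is applied to the cutoff times `u`. In direction `k` the gap between the
boxes is `r ^ (α_max / α k) * (lam ^ (α_max / α k) - 1)`, and its power `-α k` is precisely the
weight of the `L²` term. -/
lemma sobolev_muAxes_of_measurable {α₀ : ℝ} (hα₀ : 0 < α₀) (hα : ∀ k, α₀ ≤ α k ∧ α k < 2)
    (hd : 0 < d) (hβ : 1 < betaSum α) (x₀ : Fin d → ℝ) {r lam : ℝ} (hr : 0 < r) (hlam : 1 < lam)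
    {u : (Fin d → ℝ) → ℝ} (hu : Measurable u) :
    eLpNorm u (ENNReal.ofReal (2 * betaSum α / (betaSum α - 1)))
        (volume.restrict (box α r x₀)) ^ 2
      ≤ 4 * (ENNReal.ofReal (2 ^ (2 * betaSum α / (betaSum α - 1) + 1 / betaSum α)) * 2 ^ (d + 9)
        * (2 * energy (muAxes α) (box α (lam * r) x₀) u
          + 4 * ENNReal.ofReal (1 + 2 / α₀) * (ENNReal.ofReal
              (r ^ (-alphaMax α) * ∑ k, (lam ^ (alphaMax α / α k) - 1) ^ (-α k))
            * eLpNorm u 2 (volume.restrict (box α (lam * r) x₀)) ^ 2))) := by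
  have hpos : ∀ k, 0 < α k := fun k => hα₀.trans_le (hα k).1
  have hexp : ∀ k, 0 < alphaMax α / α k := fun k =>
    div_pos ((hpos k).trans_le (le_alphaMax k)) (hpos k)
  set M := box α (lam * r) x₀ with hM
  have hMm : MeasurableSet M := measurableSet_box _ _
  set lo : Fin d → ℝ := fun k => r ^ (alphaMax α / α k) with hlo
  set hi : Fin d → ℝ := fun k => (lam * r) ^ (alphaMax α / α k) with hhi
  have hlohi : ∀ k, lo k < hi k := fun k =>
    Real.rpow_lt_rpow hr.le (lt_mul_of_one_lt_left hr hlam) (hexp k)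
  have hMτ : ∀ x, x ∉ M → cutoff lo hi x₀ x = 0 := fun x hx => by
    rw [hM, mem_box_iff] at hx
    push Not at hx
    obtain ⟨k, hk⟩ := hx
    exact cutoff_eq_zero hlohi hk
  set v : (Fin d → ℝ) → ℝ := fun x => cutoff lo hi x₀ x * u x with hv
  have hvm : Measurable v := measurable_cutoff.mul hu
  have hsupp : volume {x | v x ≠ 0} ≠ ∞ := by
    refine ne_top_of_le_ne_top (volume_box_ne_top (α := α) (lam * r) x₀) (measure_mono fun x hx => ?_)
    by_contra hxM
    exact hx (by simp [hv, hMτ x hxM])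
  have huv : u =ᵐ[volume.restrict (box α r x₀)] v := by
    filter_upwards [ae_restrict_mem (measurableSet_box r x₀)] with x hx
    rw [mem_box_iff] at hx
    simp only [hv, cutoff_eq_one hlohi fun k => (hx k).le, one_mul]
  set N := ∫⁻ x in M, ENNReal.ofReal (u x ^ 2) with hN
  have hconst : ∀ k, ENNReal.ofReal ((1 + 2 / α k) * (hi k - lo k) ^ (-α k))
      ≤ ENNReal.ofReal (1 + 2 / α₀) * ENNReal.ofReal
        (r ^ (-alphaMax α) * (lam ^ (alphaMax α / α k) - 1) ^ (-α k)) := fun k => by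
    have hlam1 : 0 < lam ^ (alphaMax α / α k) - 1 := by
      linarith [Real.one_lt_rpow hlam (hexp k)]
    have hdiff : hi k - lo k = r ^ (alphaMax α / α k) * (lam ^ (alphaMax α / α k) - 1) := by
      simp only [hhi, hlo]
      rw [Real.mul_rpow (by linarith) hr.le]
      ring
    rw [hdiff, Real.mul_rpow (by positivity) hlam1.le, ← Real.rpow_mul hr.le, mul_neg,
      div_mul_cancel₀ _ (hpos k).ne', ← ENNReal.ofReal_mul (by positivity)]
    gcongr
    exact (hα k).1
  have hE : ∑ k, dirEnergy (α k) k v ≤ 2 * energy (muAxes α) M u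
      + 4 * ENNReal.ofReal (1 + 2 / α₀) * (ENNReal.ofReal
        (r ^ (-alphaMax α) * ∑ k, (lam ^ (alphaMax α / α k) - 1) ^ (-α k)) * N) := by
    calc ∑ k, dirEnergy (α k) k v
        ≤ ∑ k, (2 * (∫⁻ s in Set.Ioi (0 : ℝ), ENNReal.ofReal ((2 - α k) * s ^ (-1 - α k))
            * localSqDiff M u (Pi.single k s))
          + 4 * (ENNReal.ofReal (1 + 2 / α₀) * ENNReal.ofReal
            (r ^ (-alphaMax α) * (lam ^ (alphaMax α / α k) - 1) ^ (-α k))) * N) := by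
          refine Finset.sum_le_sum fun k _ => ?_
          refine (dirEnergy_cutoff_mul_le hMm hu hlohi hMτ (hpos k) (hα k).2 k).trans ?_
          gcongr
          exact hconst k
      _ = 2 * (∑ k, ∫⁻ s in Set.Ioi (0 : ℝ), ENNReal.ofReal ((2 - α k) * s ^ (-1 - α k))
            * localSqDiff M u (Pi.single k s))
          + 4 * ENNReal.ofReal (1 + 2 / α₀) * (ENNReal.ofReal
            (r ^ (-alphaMax α) * ∑ k, (lam ^ (alphaMax α / α k) - 1) ^ (-α k)) * N) := by
          rw [Finset.sum_add_distrib, ← Finset.mul_sum, ← Finset.sum_mul, ← Finset.mul_sum,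
            ← Finset.mul_sum, Finset.mul_sum _ _ (r ^ (-alphaMax α)),
            ENNReal.ofReal_sum_of_nonneg fun k _ => mul_nonneg (by positivity) (Real.rpow_nonneg
              (by linarith [Real.one_lt_rpow hlam (hexp k)]) _)]
          ring
      _ ≤ _ := by
          gcongr
          exact sum_lintegral_localSqDiff_le_energy hMm hu
  rw [eLpNorm_congr_ae huv, eLpNorm_two_sq]
  calc _ ≤ eLpNorm v (ENNReal.ofReal (2 * betaSum α / (betaSum α - 1))) volume ^ 2 := by
        gcongr
        exact Measure.restrict_le_self
    _ ≤ _ := eLpNorm_sq_le_dirEnergy hvm hsupp (fun k => ⟨hpos k, (hα k).2⟩) hd hβ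
    _ ≤ _ := by gcongr

lemma box_subset_box (hα : ∀ k, 0 < α k) {r R : ℝ} (hr : 0 ≤ r) (hrR : r ≤ R) (x₀ : Fin d → ℝ) :
    box α r x₀ ⊆ box α R x₀ := fun x hx => by
  rw [mem_box_iff] at hx ⊢
  exact fun k => (hx k).trans_le (Real.rpow_le_rpow hr hrR
    (div_nonneg ((hα k).le.trans (le_alphaMax k)) (hα k).le))

lemma isSobolevConstant_of_le_betaSum {α₀ Λ β₀ : ℝ} (hα₀ : 0 < α₀) (hΛ : 1 ≤ Λ)
    (hα : ∀ k, α₀ ≤ α k ∧ α k < 2) (hβ₀ : 1 < β₀) (hβ : β₀ ≤ betaSum α) :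
    IsSobolevConstant α Λ
      (2 ^ (2 * β₀ / (β₀ - 1) + 1) * 2 ^ (d + 13) * (1 + 2 / α₀) * Λ) := by
  intro μ hμ x₀ r lam hr hr1 hlam hlam2 u hu
  have hpos : ∀ k, 0 < α k := fun k => hα₀.trans_le (hα k).1
  have hd : 0 < d := by
    rcases Nat.eq_zero_or_pos d with rfl | h
    · simp [betaSum] at hβ
      linarith
    · exact h
  -- Here `lam * r ≤ 2 < 3`. Comparability is used for `u` itself; only the axes energy is
  -- transferred between `u` and its Borel version `w`.
  have hcomp := (hμ.comparability x₀ (lam * r) (by positivity) (by nlinarith) u hu.1).2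
  set w := hu.1.aestronglyMeasurable.mk u
  have hwm : Measurable w := hu.1.aestronglyMeasurable.stronglyMeasurable_mk.measurable
  have huw : u =ᵐ[volume.restrict (box α (lam * r) x₀)] w := hu.1.aestronglyMeasurable.ae_eq_mk
  have huw' : u =ᵐ[volume.restrict (box α r x₀)] w := ae_restrict_of_ae_restrict_of_subset
    (box_subset_box hpos hr.le (le_mul_of_one_le_left hr.le hlam.le) x₀) huw
  have hmain := sobolev_muAxes_of_measurable hα₀ hα hd (hβ₀.trans_le hβ) x₀ hr hlam hwm
  rw [← eLpNorm_congr_ae huw, ← eLpNorm_congr_ae huw',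
    ← energy_muAxes_congr (measurableSet_box _ _) huw] at hmain
  refine hmain.trans ?_
  set W := ENNReal.ofReal (r ^ (-alphaMax α) * ∑ k, (lam ^ (alphaMax α / α k) - 1) ^ (-α k))
    * eLpNorm u 2 (volume.restrict (box α (lam * r) x₀)) ^ 2
  set E := energy μ (box α (lam * r) x₀) u
  -- Uniformity in `α`: `2β / (β - 1)` decreases in `β`, so it is largest at `β₀`.
  have hexp : 2 * betaSum α / (betaSum α - 1) + 1 / betaSum α ≤ 2 * β₀ / (β₀ - 1) + 1 := by
    have h1 : 0 < β₀ - 1 := by linarith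
    have h2 : 0 < betaSum α - 1 := by linarith
    refine add_le_add ?_ ((div_le_one (by linarith)).2 (by linarith))
    rw [div_le_div_iff₀ h2 h1]
    nlinarith
  have hΛ' : 1 ≤ ENNReal.ofReal Λ := by simpa using hΛ
  have hc : 1 ≤ ENNReal.ofReal (1 + 2 / α₀) := by
    rw [ENNReal.one_le_ofReal]
    linarith [div_pos two_pos hα₀]
  calc _ ≤ 4 * (ENNReal.ofReal (2 ^ (2 * β₀ / (β₀ - 1) + 1)) * 2 ^ (d + 9)
          * (4 * ENNReal.ofReal (1 + 2 / α₀) * (ENNReal.ofReal Λ * E)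
            + 4 * ENNReal.ofReal (1 + 2 / α₀) * (ENNReal.ofReal Λ * W))) := by
        gcongr
        · norm_num
        · calc (2 : ℝ≥0∞) ≤ 4 * 1 := by norm_num
            _ ≤ _ := by gcongr
        · exact le_mul_of_one_le_left zero_le hΛ'
    _ = _ := by
        rw [ENNReal.ofReal_mul (by positivity), ENNReal.ofReal_mul (by positivity),
          ENNReal.ofReal_mul (by positivity), ENNReal.ofReal_pow (by norm_num),
          ENNReal.ofReal_ofNat, show d + 13 = d + 9 + 4 by rfl, pow_add _ (d + 9) 4,
          show (2 : ℝ≥0∞) ^ 4 = 4 * 4 by norm_num]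
        ring

end LocalSobolev

theorem theorem3p3 (d : ℕ) (α₀ Λ : ℝ) (hα₀ : 0 < α₀) (hα₀' : α₀ < 2) (hΛ : 1 ≤ Λ) :
    (3 ≤ d → ∃ c₁ : ℝ, 0 < c₁ ∧
      ∀ α : Fin d → ℝ, (∀ k, α₀ ≤ α k ∧ α k < 2) → IsSobolevConstant α Λ c₁) ∧
    (∀ β₀ : ℝ, 1 < β₀ → ∃ c₁ : ℝ, 0 < c₁ ∧
      ∀ α : Fin d → ℝ, (∀ k, α₀ ≤ α k ∧ α k < 2) → β₀ ≤ betaSum α →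
        IsSobolevConstant α Λ c₁) := by
  have hb : ∀ β₀ : ℝ, 1 < β₀ → ∃ c₁ : ℝ, 0 < c₁ ∧
      ∀ α : Fin d → ℝ, (∀ k, α₀ ≤ α k ∧ α k < 2) → β₀ ≤ betaSum α →
        IsSobolevConstant α Λ c₁ := fun β₀ hβ₀ =>
    ⟨_, by positivity, fun α hα hβ => isSobolevConstant_of_le_betaSum hα₀ hΛ hα hβ₀ hβ⟩
  refine ⟨fun hd => ?_, hb⟩
  -- Since every `α k < 2`, three dimensions already force `β ≥ d / 2 ≥ 3 / 2`.
  obtain ⟨c₁, hc₁, h⟩ := hb (3 / 2) (by norm_num)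
  refine ⟨c₁, hc₁, fun α hα => h α hα ?_⟩
  have hd' : (3 : ℝ) ≤ d := by exact_mod_cast hd
  calc (3 / 2 : ℝ) ≤ ∑ _k : Fin d, (1 / 2 : ℝ) := by
        rw [Finset.sum_const, Finset.card_univ, Fintype.card_fin, nsmul_eq_mul]
        linarith
    _ ≤ betaSum α := Finset.sum_le_sum fun k _ =>
        one_div_le_one_div_of_le (hα₀.trans_le (hα k).1) (hα k).2.le
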